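/- Let $\mathbb{K}$ be a field of arbitrary characteristic, let $V$ be a $\mathbb{K}$-vector space with basis $v_1,\dots,v_n$, let $G\subset \mathrm{GL}(V)$ be a finite subgroup, let $q_{ij}\in\mathbb{K}$ ($1\le i,j\le n$) be nonzero scalars and let $\kappa(v_i,v_j)\in\mathbb{K}G$ ($1\le i,j\le n$) be arbitrary elements of the group algebra, which has basis $\{t_g : g\in G\}$. Let $\mathcal{H}_{Q,\kappa}$ be the associative unital $\mathbb{K}$-algebra generated by $v_1,\dots,v_n$ and $t_g$ ($g\in G$) subject to the relations 1. $t_e=1$ and $t_gt_h=t_{gh}$ for all $g,h\in G$, 2. $t_g v=g(v)\,t_g$ for all $g\in G$, $v\in V$, 3. $v_jv_i=q_{ij}\,v_iv_j+\kappa(v_i,v_j)$ for all $1\le i,j\le n$. Call $\mathcal{H}_{Q,\kappa}$ a *quantum Drinfeld Hecke algebra* if the monomials $v_1^{\alpha_1}\cdots v_n^{\alpha_n}t_g$ ($\alpha_i\in\mathbb{N}$, $g\in G$) form a $\mathbb{K}$-basis of $\mathcal{H}_{Q,\kappa}$. **Theorem.** If $\mathcal{H}_{Q,\kappa}$ is a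 quantum Drinfeld Hecke algebra, then 1. $\mathcal{H}_{Q,\kappa}$ is (left and right) Noetherian; 2. $\mathcal{H}_{Q,\kappa}$ is a domain (nonzero and without zero divisors; commutativity is not required) if and only if $G$ is trivial; 3. $\operatorname{gkdim}\mathcal{H}_{Q,\kappa}=n+\operatorname{gkdim}\mathbb{K}$, where for a $\mathbb{K}$-algebra $A$ the Gelfand–Kirillov dimension over $\mathbb{K}$ is $\operatorname{gkdim}A=\sup_W\limsup_{m\to\infty}\log_m\dim_{\mathbb{K}}(\mathbb{K}1+W)^m$, with $W$ running over the finite-dimensional subspaces of $A$ (so that $\operatorname{gkdim}\mathbb{K}=0$); 4. if $|G|$ is not divisible by $\operatorname{char}\mathbb{K}$, then the (left and right) global homological dimension of $\mathcal{H}_{Q,\kappa}$ is at most $n$. -/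

import Mathlib

universe u v

noncomputable section

namespace QuantumDrinfeldHecke

/-- The Gelfand-Kirillov dimension of an algebra `A` over a field `K`: the supremum, over all
finite-dimensional subspaces `W` of `A`, of `limsup_m log_m (dim_K (K·1 + W)^m)`.
Note that `(K·1 + W)^m` is the sum of the `W^i` with `i ≤ m`. -/
def gkDim (K : Type u) (A : Type v) [Field K] [Ring A] [Algebra K A] : EReal :=
  ⨆ W : {W : Submodule K A // W.FG},
    Filter.limsup
      (fun m : ℕ =>
        ((Real.logb (m : ℝ) (Module.finrank K ((1 ⊔ W.1) ^ m : Submodule K A) : ℝ) : ℝ) : EReal))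
      Filter.atTop

/-- The left global (homological) dimension of a ring: the supremum of the projective dimensions
of its left modules. The right global dimension of `R` is `leftGlobalDim Rᵐᵒᵖ`. -/
def leftGlobalDim (R : Type u) [Ring R] : WithBot ℕ∞ :=
  ⨆ M : ModuleCat.{u} R, CategoryTheory.projectiveDimension M

section Construction

variable {K : Type u} {V : Type v} [Field K] [AddCommGroup V] [Module K V] {n : ℕ}
variable (G : Subgroup (LinearMap.GeneralLinearGroup K V))

/-- The free associative algebra on the symbols `v₁, …, vₙ` and `t_g` for `g` in `G`. -/
abbrev Free (K : Type u) {V : Type v} [Field K] [AddCommGroup V] [Module K V]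
    (n : ℕ) (G : Subgroup (LinearMap.GeneralLinearGroup K V)) : Type (max u v) :=
  FreeAlgebra K (Fin n ⊕ G)

/-- The generator `vᵢ`. -/
def genV (i : Fin n) : Free K n G := FreeAlgebra.ι K (Sum.inl i)

/-- The generator `t_g`. -/
def genT (n : ℕ) (g : G) : Free K n G := FreeAlgebra.ι K (Sum.inr g)

/-- The linear form in the generators `vᵢ` given by a vector `w = ∑ᵢ cᵢ vᵢ` of `V`. -/
def vec (b : Module.Basis (Fin n) K V) (w : V) : Free K n G :=
  ∑ i, b.repr w i • genV G i

/-- The expression `∑ c_g t_g` given by an element of the group algebra. -/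
def grp (n : ℕ) (a : MonoidAlgebra K G) : Free K n G :=
  a.coeff.sum fun g c => c • genT G n g

/-- The defining relations of `H_{Q,κ}`; here `q i j` is `q_{ij}` and `κ i j` is `κ(vᵢ, vⱼ)`. -/
inductive Rel (b : Module.Basis (Fin n) K V) (q : Fin n → Fin n → K)
    (κ : Fin n → Fin n → MonoidAlgebra K G) : Free K n G → Free K n G → Prop
  | one : Rel b q κ (genT G n 1) 1
  | mul (g h : G) : Rel b q κ (genT G n g * genT G n h) (genT G n (g * h))
  | act (g : G) (w : V) :
      Rel b q κ (genT G n g * vec G b w) (vec G b (g.1.1 w) * genT G n g)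
  | comm (i j : Fin n) :
      Rel b q κ (genV G j * genV G i) (q i j • (genV G i * genV G j) + grp G n (κ i j))

/-- The `K`-algebra `H_{Q,κ}` given by generators and relations. -/
def Hecke (b : Module.Basis (Fin n) K V) (q : Fin n → Fin n → K)
    (κ : Fin n → Fin n → MonoidAlgebra K G) : Type (max u v) :=
  RingQuot (Rel G b q κ)

instance (b : Module.Basis (Fin n) K V) (q : Fin n → Fin n → K)
    (κ : Fin n → Fin n → MonoidAlgebra K G) : Ring (Hecke G b q κ) :=
  inferInstanceAs (Ring (RingQuot (Rel G b q κ)))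

instance (b : Module.Basis (Fin n) K V) (q : Fin n → Fin n → K)
    (κ : Fin n → Fin n → MonoidAlgebra K G) : Algebra K (Hecke G b q κ) :=
  inferInstanceAs (Algebra K (RingQuot (Rel G b q κ)))

/-- The quotient map from the free algebra onto `H_{Q,κ}`. -/
def toHecke (b : Module.Basis (Fin n) K V) (q : Fin n → Fin n → K)
    (κ : Fin n → Fin n → MonoidAlgebra K G) : Free K n G →ₐ[K] Hecke G b q κ :=
  RingQuot.mkAlgHom K (Rel G b q κ)

/-- The quasi-standard monomial `v₁^α₁ ⋯ vₙ^αₙ t_g` in `H_{Q,κ}`. -/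
def monomial (b : Module.Basis (Fin n) K V) (q : Fin n → Fin n → K)
    (κ : Fin n → Fin n → MonoidAlgebra K G) (x : (Fin n → ℕ) × G) : Hecke G b q κ :=
  toHecke G b q κ
    ((List.ofFn fun i : Fin n => genV G i ^ x.1 i).prod * genT G n x.2)

/-- `H_{Q,κ}` is a quantum Drinfeld Hecke algebra: the quasi-standard monomials form a
`K`-basis. -/
def IsQuantumDrinfeldHecke (b : Module.Basis (Fin n) K V) (q : Fin n → Fin n → K)
    (κ : Fin n → Fin n → MonoidAlgebra K G) : Prop :=
  LinearIndependent K (monomial G b q κ) ∧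
    Submodule.span K (Set.range (monomial G b q κ)) = ⊤

end Construction

end QuantumDrinfeldHecke

end

-- Filter `H` by degree in the `v i`, with the group elements in degree zero. The relations let
-- words be reordered up to nonzero scalars and terms of lower degree, and the monomial basis says
-- that nothing collapses: up to lower terms, `H` behaves like a skew polynomial ring in `n`
-- variables with `G` attached. Each claim is read off leading terms.
--
-- Noetherian: the leading coefficients of a left ideal at an exponent form a subspace of `G → K`
-- that grows with the exponent; Dickson's lemma and finite dimension stop ascending chains
-- (`lead_mono_right`, `le_of_lead_le`). The right-hand statements follow because the opposite
-- algebra has the same kind of basis (`IsPBW.opposite`). Domain: for trivial `G` leading monomials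
-- multiply to a nonzero multiple of a monomial; otherwise `(t g - 1) * ∑ k, t k = 0`. Growth:
-- degree at most `p` gives a dimension of order `p ^ n`. Global dimension: the generators are a
-- regular sequence on the associated graded module of `H`. In a filtered free resolution every
-- kernel gains one more regular generator (`regular_kerFiltration`), and after `n` steps Maschke's
-- theorem makes the kernel projective (`projective_of_regular`).

universe w

noncomputable section

/-! ### Modules over a ring with quasi-commuting generators. -/

namespace FilteredModule

variable {R : Type u} [Ring R] {S : Subring R} {n : ℕ} {x : Fin n → R}

/-- The elements `x i` commute with each other up to a scalar and an error term in the subring `S`,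
and `S` can be moved to the right of them. -/
structure QuasiCommuting (S : Subring R) (x : Fin n → R) : Prop where
  comm : ∀ i j, ∃ c ∈ S, ∃ s ∈ S, x i * x j = x j * x i * c + s
  act : ∀ s ∈ S, ∀ i, ∃ c : Fin n → R, (∀ j, c j ∈ S) ∧ s * x i = ∑ j, x j * c j

section Initial

variable {M : Type v} [AddCommGroup M] [Module R M]

/-- The additive subgroup `A + ∑ j < k, x j • A`. -/
def initial (x : Fin n → R) (A : Submodule S M) : ℕ → AddSubgroup M
  | 0 => A.toAddSubgroup
  | k + 1 => initial x A k ⊔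
      if h : k < n then A.toAddSubgroup.map (DistribSMul.toAddMonoidHom M (x ⟨k, h⟩)) else ⊥

@[simp] lemma mem_initial_zero {A : Submodule S M} {m : M} : m ∈ initial x A 0 ↔ m ∈ A := Iff.rfl

lemma mem_initial_succ {A : Submodule S M} {m : M} (i : Fin n) :
    m ∈ initial x A (i + 1) ↔ ∃ a ∈ initial x A i, ∃ b ∈ A, a + x i • b = m := by
  simp [initial, AddSubgroup.mem_sup]

lemma initial_succ_of_le {A : Submodule S M} {k : ℕ} (h : n ≤ k) :
    initial x A (k + 1) = initial x A k := by
  simp [initial, not_lt.2 h]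

lemma initial_le_succ (A : Submodule S M) (k : ℕ) : initial x A k ≤ initial x A (k + 1) :=
  le_sup_left

lemma initial_mono_right (A : Submodule S M) : Monotone (initial x A) :=
  monotone_nat_of_le_succ (initial_le_succ A)

lemma mem_initial_of_mem {A : Submodule S M} {m : M} (h : m ∈ A) (k : ℕ) : m ∈ initial x A k :=
  initial_mono_right A (Nat.zero_le k) h

lemma smul_mem_initial {A : Submodule S M} {m : M} (h : m ∈ A) (i : Fin n) {k : ℕ}
    (hk : (i : ℕ) < k) : x i • m ∈ initial x A k :=
  initial_mono_right A hk ((mem_initial_succ i).2 ⟨0, zero_mem _, m, h, zero_add _⟩)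

/-- Induction along the recursive definition of `initial`. -/
lemma initial_induction {A : Submodule S M} {k : ℕ} {B : AddSubgroup M}
    (h0 : ∀ m ∈ A, m ∈ B) (h1 : ∀ i : Fin n, (i : ℕ) < k → ∀ m ∈ A, x i • m ∈ B) :
    initial x A k ≤ B := by
  induction k with
  | zero => exact h0
  | succ k ih =>
    have ih := ih fun i hi => h1 i (by omega)
    by_cases hk : k < n
    · intro m hm
      obtain ⟨a, ha, b, hb, rfl⟩ := (mem_initial_succ ⟨k, hk⟩).1 hm
      exact add_mem (ih ha) (h1 _ (Nat.lt_succ_self k) b hb)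
    · rwa [initial_succ_of_le (not_lt.1 hk)]

lemma initial_bot (k : ℕ) : initial x (⊥ : Submodule S M) k = ⊥ :=
  le_bot_iff.1 (initial_induction (fun m hm => hm) fun i _ m hm => by
    rw [(Submodule.mem_bot S).1 hm, smul_zero]; exact zero_mem _)

/-- Swapping `x i` past `x j` keeps the same `x j` on the left and leaves an error without
generators, so partial sums over `j < k` are respected. -/
lemma smul_initial (hx : QuasiCommuting S x) {A B : Submodule S M} (hAB : A ≤ B)
    (hB : ∀ i, ∀ m ∈ A, x i • m ∈ B) {k : ℕ} (i : Fin n) {m : M} (hm : m ∈ initial x A k) :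
    x i • m ∈ initial x B k := by
  refine initial_induction (A := A) (B := (initial x B k).comap (DistribSMul.toAddMonoidHom M (x i)))
    (fun m hm => mem_initial_of_mem (hB i m hm) k) (fun j hj m hm => ?_) hm
  obtain ⟨c, hc, s, hs, h⟩ := hx.comm i j
  change x i • x j • m ∈ initial x B k
  rw [← mul_smul, h, add_smul, mul_smul, mul_smul]
  exact add_mem (smul_mem_initial (hB i _ (A.smul_mem ⟨c, hc⟩ hm)) j hj)
    (mem_initial_of_mem (hAB (A.smul_mem ⟨s, hs⟩ hm)) k)

/-- The `S`-submodule `A + ∑ j, x j • A`. -/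
def extend (hx : QuasiCommuting S x) (A : Submodule S M) : Submodule S M where
  __ := initial x A n
  smul_mem' := by
    intro s m hm
    refine initial_induction
      (A := A) (B := (initial x A n).comap (DistribSMul.toAddMonoidHom M (s : R)))
      (fun m hm => mem_initial_of_mem (A.smul_mem s hm) n) (fun j hj m hm => ?_) hm
    -- Moving `s` past `x j` may bring in every generator. Only the full sum is thus seen to be
    -- `S`-stable, and the partial sums `initial` are kept as additive subgroups.
    obtain ⟨c, hc, h⟩ := hx.act s s.2 j
    change (s : R) • x j • m ∈ initial x A n
    rw [← mul_smul, h, Finset.sum_smul]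
    refine sum_mem fun j _ => ?_
    rw [mul_smul]
    exact smul_mem_initial (A.smul_mem ⟨c j, hc j⟩ hm) j j.2

@[simp] lemma mem_extend {hx : QuasiCommuting S x} {A : Submodule S M} {m : M} :
    m ∈ extend hx A ↔ m ∈ initial x A n := Iff.rfl

lemma le_extend (hx : QuasiCommuting S x) (A : Submodule S M) : A ≤ extend hx A :=
  fun _ hm => mem_initial_of_mem hm n

/-- The filtration generated by `Y p` in degree `p`, shifted by one. -/
def generated (hx : QuasiCommuting S x) (Y : ℕ → Submodule S M) : ℕ → Submodule S M
  | 0 => ⊥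
  | p + 1 => Y p ⊔ extend hx (generated hx Y p)

lemma initial_le_generated (hx : QuasiCommuting S x) (Y : ℕ → Submodule S M) (p : ℕ) :
    extend hx (generated hx Y p) ≤ generated hx Y (p + 1) := le_sup_right

lemma generated_mono (hx : QuasiCommuting S x) (Y : ℕ → Submodule S M) :
    Monotone (generated hx Y) :=
  monotone_nat_of_le_succ fun p => (le_extend hx _).trans (initial_le_generated hx Y p)

lemma smul_mem_generated (hx : QuasiCommuting S x) (Y : ℕ → Submodule S M) {p : ℕ} (i : Fin n)
    {m : M} (hm : m ∈ generated hx Y p) : x i • m ∈ generated hx Y (p + 1) :=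
  initial_le_generated hx Y p (smul_mem_initial hm i i.2)

end Initial

/-! ### Regular sequences on the associated graded module and kernels of strict maps. -/

section Filtration

variable (S x) in
/-- An increasing filtration starting with `0`, for which `S` has degree `0` and
each `x i` has degree `1`. -/
structure IsFiltration {M : Type v} [AddCommGroup M] [Module R M] (F : ℕ → Submodule S M) :
    Prop where
  zero : F 0 = ⊥
  mono : Monotone F
  smul : ∀ p i, ∀ m ∈ F p, x i • m ∈ F (p + 1)
  exists_mem : ∀ m, ∃ p, m ∈ F p

variable (x) in
/-- The elements `x 0, …, x (k - 1)` form a regular sequence on the associated graded module. -/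
def Regular {M : Type v} [AddCommGroup M] [Module R M] (F : ℕ → Submodule S M) (k : ℕ) : Prop :=
  ∀ i : Fin n, (i : ℕ) < k → ∀ p, ∀ m ∈ F (p + 1),
    x i • m ∈ initial x (F (p + 1)) i → m ∈ initial x (F p) i

variable {P : Type v} {N : Type w} [AddCommGroup P] [Module R P] [AddCommGroup N] [Module R N]

/-- The filtration induced on the kernel of a linear map. -/
def kerFiltration (f : P →ₗ[R] N) (F : ℕ → Submodule S P) (p : ℕ) :
    Submodule S (LinearMap.ker f) :=
  (F p).comap ((LinearMap.ker f).subtype.restrictScalars S)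

@[simp] lemma mem_kerFiltration {f : P →ₗ[R] N} {F : ℕ → Submodule S P} {p : ℕ}
    {z : LinearMap.ker f} : z ∈ kerFiltration f F p ↔ (z : P) ∈ F p := Iff.rfl

lemma exists_mem_initial_of_map {f : P →ₗ[R] N} {A : Submodule S P} {B : Submodule S N}
    (h : ∀ y ∈ B, ∃ m ∈ A, f m = y) {k : ℕ} {y : N} (hy : y ∈ initial x B k) :
    ∃ m ∈ initial x A k, f m = y := by
  have := initial_induction (x := x) (k := k) (A := B)
    (B := (initial x A k).map f.toAddMonoidHom) ?_ ?_ hy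
  · simpa using this
  · intro y hy
    obtain ⟨m, hm, rfl⟩ := h y hy
    exact ⟨m, mem_initial_of_mem hm k, rfl⟩
  · intro i hi y hy
    obtain ⟨m, hm, rfl⟩ := h y hy
    exact ⟨x i • m, smul_mem_initial hm i hi, map_smul f _ _⟩

lemma map_mem_initial {f : P →ₗ[R] N} {A : Submodule S P} {B : Submodule S N}
    (h : ∀ m ∈ A, f m ∈ B) {k : ℕ} {m : P} (hm : m ∈ initial x A k) :
    f m ∈ initial x B k := by
  refine initial_induction (x := x) (k := k) (A := A)
    (B := (initial x B k).comap f.toAddMonoidHom) ?_ ?_ hm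
  · exact fun m hm => mem_initial_of_mem (h m hm) k
  · intro i hi m hm
    change f (x i • m) ∈ initial x B k
    rw [map_smul]
    exact smul_mem_initial (h m hm) i hi

/-- Strictness of the kernel for the initial parts, given regularity of the image. -/
lemma mem_initial_kerFiltration (hx : QuasiCommuting S x) {f : P →ₗ[R] N}
    {FP : ℕ → Submodule S P} {FN : ℕ → Submodule S N} (h0 : FP 0 = ⊥) (hmono : Monotone FP)
    (hsmul : ∀ p i, ∀ m ∈ FP p, x i • m ∈ FP (p + 1))
    (hmap : ∀ p, ∀ m ∈ FP p, f m ∈ FN p) (hstrict : ∀ p, ∀ y ∈ FN p, ∃ m ∈ FP p, f m = y)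
    {k : ℕ} (hreg : Regular x FN k) {l : ℕ} (hl : l ≤ k) (p : ℕ) :
    ∀ z : LinearMap.ker f, (z : P) ∈ initial x (FP p) l →
      z ∈ initial x (kerFiltration f FP p) l := by
  cases p with
  | zero =>
    intro z hz
    rw [h0, initial_bot, AddSubgroup.mem_bot] at hz
    rw [show z = 0 from Subtype.ext hz]
    exact zero_mem _
  | succ p =>
    induction l with
    | zero => exact fun z hz => hz
    | succ l ih =>
      by_cases hln : l < n
      swap
      · rw [initial_succ_of_le (not_lt.1 hln), initial_succ_of_le (not_lt.1 hln)]
        exact ih (by omega)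
      intro z hz
      obtain ⟨a, ha, b, hb, hab⟩ := (mem_initial_succ ⟨l, hln⟩).1 hz
      have hfz : f z = 0 := z.2
      have hxb : x ⟨l, hln⟩ • f b = - f a := by
        rw [← map_smul, eq_neg_iff_add_eq_zero, ← map_add, add_comm, hab, hfz]
      -- Applying `f` to `z = a + x l • b` puts `x l • f b` among the earlier generators, so
      -- regularity of the target lowers the degree of `f b`.
      have hfb : f b ∈ initial x (FN p) l := by
        refine hreg ⟨l, hln⟩ (by simpa using hl) p (f b) (hmap _ _ hb) ?_
        rw [hxb]
        exact neg_mem (map_mem_initial (hmap (p + 1)) ha)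
      obtain ⟨b', hb', hbb⟩ := exists_mem_initial_of_map (hstrict p) hfb
      have hb'' : b' ∈ FP (p + 1) :=
        initial_induction (x := x) (B := (FP (p + 1)).toAddSubgroup)
          (fun m hm => hmono (Nat.le_succ p) hm) (fun i _ m hm => hsmul p i m hm) hb'
      -- Correcting `b` by a lift `b'` of `f b` gives a kernel element. Replacing `b` by it changes
      -- `z` by `x l • b'`, which involves only generators before `l`.
      let c : LinearMap.ker f := ⟨b - b', by simp [hbb]⟩
      have hc : c ∈ kerFiltration f FP (p + 1) := sub_mem hb hb''
      have key := ih (by omega) (z - x ⟨l, hln⟩ • c) (by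
        have : ((z - x ⟨l, hln⟩ • c : LinearMap.ker f) : P) = a + x ⟨l, hln⟩ • b' := by
          simp only [AddSubgroupClass.coe_sub, Submodule.coe_smul, c, ← hab, smul_sub]
          abel
        rw [this]
        exact add_mem ha (smul_initial hx (hmono (Nat.le_succ p)) (hsmul p) _ hb'))
      exact (mem_initial_succ ⟨l, hln⟩).2 ⟨_, key, c, hc, by simp⟩

/-- A relation in the kernel is solved in `P`, and strictness pulls the solution back to the kernel.
Strictness at stage `i` uses only the generators before `i`, hence the gain from `k` to `k + 1`. -/
lemma regular_kerFiltration (hx : QuasiCommuting S x) {f : P →ₗ[R] N}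
    {FP : ℕ → Submodule S P} {FN : ℕ → Submodule S N} (hFP : IsFiltration S x FP)
    (hmap : ∀ p, ∀ m ∈ FP p, f m ∈ FN p) (hstrict : ∀ p, ∀ y ∈ FN p, ∃ m ∈ FP p, f m = y)
    {k : ℕ} (hreg : Regular x FN k) (hP : Regular x FP (k + 1)) :
    Regular x (kerFiltration f FP) (k + 1) := by
  intro i hi p z hz hxz
  have hi' : (i : ℕ) ≤ k := by omega
  refine mem_initial_kerFiltration hx hFP.zero hFP.mono hFP.smul hmap hstrict hreg hi' p z ?_
  refine hP i hi p z hz ?_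
  exact map_mem_initial (f := (LinearMap.ker f).subtype) (fun m hm => hm) hxz

lemma isFiltration_kerFiltration {f : P →ₗ[R] N} {FP : ℕ → Submodule S P}
    (hFP : IsFiltration S x FP) : IsFiltration S x (kerFiltration f FP) where
  zero := by
    ext z
    rw [mem_kerFiltration, hFP.zero]
    simp
  mono := fun _ _ h _ hz => hFP.mono h hz
  smul := fun p i z hz => hFP.smul p i z hz
  exists_mem := fun z => hFP.exists_mem z

end Filtration

/-! ### Filtered free covers. -/

section Cover

variable {M : Type v} [AddCommGroup M] [Module R M]

/-- The filtration of `R` by words in the `x i` with coefficients in `S`, shifted by one. -/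
def ringFiltration (hx : QuasiCommuting S x) : ℕ → Submodule S R :=
  generated hx fun _ => Submodule.span S {1}

lemma mem_ringFiltration_one (hx : QuasiCommuting S x) (p : ℕ) {s : R} (hs : s ∈ S) :
    s ∈ ringFiltration hx (p + 1) :=
  Submodule.mem_sup_left (Submodule.mem_span_singleton.2 ⟨⟨s, hs⟩, mul_one s⟩)

/-- Index `p + 1` means degree at most `p`, so additivity of degrees loses one from the sum of the
indices. -/
lemma ringFiltration_smul_mem (hx : QuasiCommuting S x) {F : ℕ → Submodule S M}
    (hmono : Monotone F) (hsmul : ∀ p i, ∀ m ∈ F p, x i • m ∈ F (p + 1)) {q d : ℕ} {r : R} (hr : r ∈ ringFiltration hx q) {m : M}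
    (hm : m ∈ F (d + 1)) : r • m ∈ F (d + q) := by
  induction q generalizing r with
  | zero =>
    rw [(Submodule.mem_bot S).1 hr, zero_smul]
    exact zero_mem _
  | succ q ih =>
    obtain ⟨a, ha, b, hb, rfl⟩ := Submodule.mem_sup.1 hr
    rw [add_smul]
    refine add_mem ?_ ?_
    · obtain ⟨s, rfl⟩ := Submodule.mem_span_singleton.1 ha
      refine hmono (show d + 1 ≤ d + (q + 1) by omega) ?_
      simpa [Subring.smul_def] using (F (d + 1)).smul_mem s hm
    · refine initial_induction (x := x) (k := n) (A := generated hx _ q)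
        (B := (F (d + (q + 1))).toAddSubgroup.comap (LinearMap.toSpanSingleton R M m).toAddMonoidHom)
        ?_ ?_ hb
      · exact fun r hr => hmono (show d + q ≤ d + (q + 1) by omega) (ih hr)
      · intro i _ r hr
        change (x i * r) • m ∈ F (d + (q + 1))
        rw [mul_smul]
        exact hsmul _ i _ (ih hr)

/-- The filtration on a free module whose generator `j` lies in degree `d j`. -/
def freeFiltration (hx : QuasiCommuting S x) {J : Type v} (d : J → ℕ) (p : ℕ) :
    Submodule S (J →₀ R) where
  -- Truncated subtraction is intended: for `p ≤ d j` the condition is `f j = 0`.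
  carrier := {f | ∀ j, f j ∈ ringFiltration hx (p - d j)}
  add_mem' := fun hf hg j => add_mem (hf j) (hg j)
  zero_mem' := fun _ => zero_mem _
  smul_mem' := fun s _ hf j => (ringFiltration hx (p - d j)).smul_mem s (hf j)

@[simp] lemma mem_freeFiltration {hx : QuasiCommuting S x} {J : Type v} {d : J → ℕ} {p : ℕ}
    {f : J →₀ R} : f ∈ freeFiltration hx d p ↔ ∀ j, f j ∈ ringFiltration hx (p - d j) := Iff.rfl

lemma isFiltration_freeFiltration (hx : QuasiCommuting S x)
    (hR : IsFiltration S x (ringFiltration hx)) {J : Type v} (d : J → ℕ) :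
    IsFiltration S x (freeFiltration hx d) where
  zero := by
    refine le_bot_iff.1 fun f hf => ?_
    refine (Submodule.mem_bot S).2 (Finsupp.ext fun j => ?_)
    have := hf j
    rwa [Nat.zero_sub, hR.zero] at this
  mono := fun p q h f hf j => hR.mono (by omega) (hf j)
  smul := by
    intro p i f hf j
    rcases le_total p (d j) with h | h
    · have := hf j
      rw [Nat.sub_eq_zero_of_le h, hR.zero, Submodule.mem_bot] at this
      simp [this]
    · rw [show p + 1 - d j = p - d j + 1 by omega]
      exact hR.smul _ i _ (hf j)
  exists_mem := by
    intro f
    choose p hp using fun j => hR.exists_mem (f j)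
    refine ⟨f.support.sup fun j => p j + d j, fun j => ?_⟩
    by_cases hj : j ∈ f.support
    · have := Finset.le_sup (f := fun j => p j + d j) hj
      exact hR.mono (by omega) (hp j)
    · rw [Finsupp.notMem_support_iff.1 hj]
      exact zero_mem _

lemma mem_initial_freeFiltration (hx : QuasiCommuting S x) {J : Type v} {d : J → ℕ} {p k : ℕ}
    {f : J →₀ R} : f ∈ initial x (freeFiltration hx d p) k ↔
      ∀ j, f j ∈ initial x (ringFiltration hx (p - d j)) k := by
  classical
  constructor
  · intro hf j
    exact map_mem_initial (A := freeFiltration hx d p) (f := Finsupp.lapply j) (fun g hg => hg j) hf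
  · intro hf
    rw [← Finsupp.sum_single f]
    refine sum_mem fun j _ => ?_
    refine map_mem_initial (f := Finsupp.lsingle j) (fun r hr => ?_) (hf j)
    intro i
    rw [Finsupp.lsingle_apply, Finsupp.single_apply]
    split_ifs with h
    · exact h ▸ hr
    · exact zero_mem _

lemma regular_freeFiltration (hx : QuasiCommuting S x) {k : ℕ}
    (hR : Regular x (ringFiltration hx) k) {J : Type v} (d : J → ℕ) :
    Regular x (freeFiltration hx d) k := by
  intro i hi p f hf hxf
  rw [mem_initial_freeFiltration] at hxf ⊢
  intro j
  rcases lt_or_ge p (d j) with h | h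
  · have := hf j
    rw [Nat.sub_eq_zero_of_le h] at this
    rw [(Submodule.mem_bot S).1 this]
    exact zero_mem _
  · have h1 := hf j
    have h2 := hxf j
    rw [show p + 1 - d j = p - d j + 1 by omega] at h1 h2
    exact hR i hi _ _ h1 h2

/-- The generators of the standard free cover of a filtered module. -/
abbrev CoverIndex (F : ℕ → Submodule S M) : Type v := Σ p : ℕ, F (p + 1)

/-- The standard free cover of a filtered module. -/
def cover (F : ℕ → Submodule S M) : (CoverIndex F →₀ R) →ₗ[R] M :=
  Finsupp.linearCombination R fun j => (j.2 : M)

lemma cover_mem (hx : QuasiCommuting S x) {F : ℕ → Submodule S M} (hF : IsFiltration S x F)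
    (p : ℕ) : ∀ f ∈ freeFiltration hx (fun j : CoverIndex F => j.1) p, cover F f ∈ F p := by
  intro f hf
  rw [cover, Finsupp.linearCombination_apply]
  refine sum_mem fun j _ => ?_
  rcases le_total p j.1 with h | h
  · have := hf j
    rw [Nat.sub_eq_zero_of_le h] at this
    change f j • (j.2 : M) ∈ F p
    rw [(Submodule.mem_bot S).1 this, zero_smul]
    exact zero_mem _
  · have := ringFiltration_smul_mem hx hF.mono hF.smul (hf j) j.2.2
    rwa [show j.1 + (p - j.1) = p by omega] at this

lemma exists_cover (hx : QuasiCommuting S x) {F : ℕ → Submodule S M} (hF : IsFiltration S x F)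
    (p : ℕ) : ∀ y ∈ F p, ∃ f ∈ freeFiltration hx (fun j : CoverIndex F => j.1) p,
      cover F f = y := by
  classical
  intro y hy
  cases p with
  | zero =>
    rw [hF.zero, Submodule.mem_bot] at hy
    exact ⟨0, zero_mem _, by rw [map_zero, hy]⟩
  | succ p =>
    refine ⟨Finsupp.single ⟨p, y, hy⟩ 1, fun j => ?_, by simp [cover]⟩
    rw [Finsupp.single_apply]
    split_ifs with h
    · subst h
      simpa using mem_ringFiltration_one hx 0 S.one_mem
    · exact zero_mem _

lemma cover_surjective (hx : QuasiCommuting S x) {F : ℕ → Submodule S M}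
    (hF : IsFiltration S x F) : Function.Surjective (cover (R := R) F) := fun y => by
  obtain ⟨p, hp⟩ := hF.exists_mem y
  obtain ⟨f, -, h⟩ := exists_cover hx hF p y hp
  exact ⟨f, h⟩

end Cover

end FilteredModule

/-! ### Projectivity over a semisimple base and the bound on global dimension. -/

namespace FilteredModule

variable {R : Type u} [Ring R] {S : Subring R} {n : ℕ} {x : Fin n → R}

section Projective

lemma exists_relative_complement {A : Type v} [AddCommGroup A] [Module S A] [IsSemisimpleRing S]
    {B C : Submodule S A} (h : B ≤ C) : ∃ Y : Submodule S A, Y ⊓ B = ⊥ ∧ Y ⊔ B = C := by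
  obtain ⟨D, hD⟩ := exists_isCompl B
  refine ⟨D ⊓ C, ?_, ?_⟩
  · rw [inf_right_comm, inf_comm D B, hD.inf_eq_bot, bot_inf_eq]
  · rw [sup_comm, ← sup_inf_assoc_of_le D h, hD.sup_eq_top, top_inf_eq]

variable {M : Type v} [AddCommGroup M] [Module R M]

/-- Over a semisimple base, a filtered module on whose associated graded module
`x 0, …, x (n - 1)` is a regular sequence is projective. -/
theorem projective_of_regular [IsSemisimpleRing S] (hx : QuasiCommuting S x)
    (hR : IsFiltration S x (ringFiltration hx)) {F : ℕ → Submodule S M}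
    (hF : IsFiltration S x F) (hreg : Regular x F n) : Module.Projective R M := by
  let f : (CoverIndex F →₀ R) →ₗ[R] M := cover F
  let Q := freeFiltration hx fun j : CoverIndex F => j.1
  have hQ : IsFiltration S x Q := isFiltration_freeFiltration hx hR _
  let B (p : ℕ) : Submodule S (CoverIndex F →₀ R) :=
    Q (p + 1) ⊓ (extend hx (F p)).comap (f.restrictScalars S)
  -- `B p` collects the elements whose image is already reached from lower degree, so `Y p` lifts
  -- the degree `p` part of the graded module modulo the generators. Semisimplicity of `S` provides
  -- the complement.
  choose Y hYB hYQ using fun p => exists_relative_complement (inf_le_left : B p ≤ Q (p + 1))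
  have hY (p : ℕ) : Y p ≤ Q (p + 1) := hYQ p ▸ le_sup_left
  let E := generated hx Y
  have hEQ (p : ℕ) : E p ≤ Q p := by
    induction p with
    | zero => exact bot_le
    | succ p ih =>
      refine sup_le (hY p) fun m hm => ?_
      exact initial_induction (B := (Q (p + 1)).toAddSubgroup)
        (fun m hm => hQ.mono (Nat.le_succ p) (ih hm)) (fun i _ m hm => hQ.smul p i m (ih hm)) hm
  have hmap (p : ℕ) : ∀ m ∈ E p, f m ∈ F p := fun m hm => cover_mem hx hF p m (hEQ p hm)
  have hstrict (p : ℕ) : ∀ y ∈ F p, ∃ m ∈ E p, f m = y := by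
    induction p with
    | zero =>
      intro y hy
      rw [hF.zero, Submodule.mem_bot] at hy
      exact ⟨0, zero_mem _, by rw [map_zero, hy]⟩
    | succ p ih =>
      intro y hy
      obtain ⟨m, hm, rfl⟩ := exists_cover hx hF (p + 1) y hy
      change m ∈ Q (p + 1) at hm
      rw [← hYQ p] at hm
      obtain ⟨a, ha, b, hb, rfl⟩ := Submodule.mem_sup.1 hm
      obtain ⟨m, hm, h⟩ := exists_mem_initial_of_map ih hb.2
      exact ⟨a + m, Submodule.add_mem_sup ha hm, by
        rw [map_add, h]; exact (map_add f a b).symm⟩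
  have hker (p : ℕ) : ∀ z ∈ E p, f z = 0 → z = 0 := by
    induction p with
    | zero => exact fun z hz _ => (Submodule.mem_bot S).1 hz
    | succ p ih =>
      intro z hz hfz
      obtain ⟨a, ha, b, hb, rfl⟩ := Submodule.mem_sup.1 hz
      have hfa : f a ∈ initial x (F p) n := by
        rw [map_add] at hfz
        rw [eq_neg_of_add_eq_zero_left hfz]
        exact neg_mem (map_mem_initial (hmap p) hb)
      -- The new part of a kernel element has image of lower origin, so it lies in both complements
      -- and vanishes; strictness reduces the rest to degree below.
      have ha0 : a ∈ Y p ⊓ B p := ⟨ha, hY p ha, hfa⟩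
      rw [hYB, Submodule.mem_bot] at ha0
      subst ha0
      rw [zero_add] at hfz ⊢
      have key := mem_initial_kerFiltration hx (f := f) rfl (generated_mono hx Y)
        (fun p i m hm => smul_mem_generated hx Y i hm) hmap hstrict hreg le_rfl p ⟨b, hfz⟩ hb
      have hbot : kerFiltration f E p = ⊥ :=
        le_bot_iff.1 fun z hz => (Submodule.mem_bot S).2 (Subtype.ext (ih z hz z.2))
      rw [hbot, initial_bot, AddSubgroup.mem_bot] at key
      exact congrArg Subtype.val key
  have hEmono : Monotone E := generated_mono hx Y
  -- The lifts generate a submodule of the free cover that `f` maps isomorphically to `M`; its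
  -- inverse splits `f`.
  let E' : Submodule R (CoverIndex F →₀ R) :=
    { carrier := {m | ∃ p, m ∈ E p}
      add_mem' := by
        rintro a b ⟨p, hp⟩ ⟨q, hq⟩
        exact ⟨max p q, add_mem (hEmono (le_max_left p q) hp) (hEmono (le_max_right p q) hq)⟩
      zero_mem' := ⟨0, zero_mem _⟩
      smul_mem' := by
        rintro r m ⟨p, hp⟩
        obtain ⟨q, hq⟩ := hR.exists_mem r
        exact ⟨p + q, ringFiltration_smul_mem hx hEmono
          (fun p i m hm => smul_mem_generated hx Y i hm) hq (hEmono (Nat.le_succ p) hp)⟩ }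
  have hbij : Function.Bijective (f ∘ₗ E'.subtype) := by
    constructor
    · refine (injective_iff_map_eq_zero _).2 ?_
      rintro ⟨m, p, hp⟩ h
      exact Subtype.ext (hker p m hp h)
    · intro y
      obtain ⟨p, hp⟩ := hF.exists_mem y
      obtain ⟨m, hm, h⟩ := hstrict p y hp
      exact ⟨⟨m, p, hm⟩, h⟩
  let e := LinearEquiv.ofBijective _ hbij
  exact Module.Projective.of_split (E'.subtype ∘ₗ e.symm.toLinearMap) f
    (LinearMap.ext fun y => e.apply_symm_apply y)

end Projective

section Dimension

open CategoryTheory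

/-- Dimension shifting: the kernel of the free cover trades one unit of `d` for one more regular
generator. -/
theorem hasProjectiveDimensionLT_of_regular [IsSemisimpleRing S] (hx : QuasiCommuting S x)
    (hR : IsFiltration S x (ringFiltration hx)) (hreg : Regular x (ringFiltration hx) n)
    (d : ℕ) {M : Type u} [AddCommGroup M] [Module R M] {F : ℕ → Submodule S M}
    (hF : IsFiltration S x F) {k : ℕ} (hk : k + d = n) (hM : Regular x F k) :
    HasProjectiveDimensionLT (ModuleCat.of R M) (d + 1) := by
  induction d generalizing M k with
  | zero =>
    obtain rfl : k = n := by omega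
    rw [zero_add, ← projective_iff_hasProjectiveDimensionLT_one,
      ← IsProjective.iff_projective]
    exact projective_of_regular hx hR hF hM
  | succ d ih =>
    have hS := LinearMap.shortExact_shortComplexKer (cover_surjective (R := R) hx hF)
    have hproj : Projective (ModuleCat.of R (CoverIndex F →₀ R)) :=
      (IsProjective.iff_projective _).1 inferInstance
    refine hS.hasProjectiveDimensionLT_X₃ (d + 1) ?_ ?_
    · refine ih (isFiltration_kerFiltration (isFiltration_freeFiltration hx hR Sigma.fst))
        (k := k + 1) (by omega) ?_
      refine regular_kerFiltration hx (isFiltration_freeFiltration hx hR Sigma.fst) (cover_mem hx hF)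
        (exists_cover hx hF) hM (regular_freeFiltration hx ?_ Sigma.fst)
      exact fun i _ => hreg i i.2
    · change HasProjectiveDimensionLT (ModuleCat.of R (CoverIndex F →₀ R)) _
      exact hasProjectiveDimensionLT_of_ge _ 1 _ (by omega)

theorem leftGlobalDim_le [IsSemisimpleRing S] (hx : QuasiCommuting S x)
    (hR : IsFiltration S x (ringFiltration hx)) (hreg : Regular x (ringFiltration hx) n) :
    QuantumDrinfeldHecke.leftGlobalDim R ≤ (n : WithBot ℕ∞) := by
  refine iSup_le fun M => (projectiveDimension_le_iff M n).2 ?_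
  -- With everything in degree zero any module is filtered; no regularity is needed to start at `k =
  -- 0`.
  let F : ℕ → Submodule S M := fun p => if p = 0 then ⊥ else ⊤
  have hF : IsFiltration S x F :=
    { zero := if_pos rfl
      mono := fun p q h => by
        by_cases hp : p = 0
        · simp [F, hp]
        · simp [F, show q ≠ 0 by omega]
      smul := fun p i m _ => by simp [F]
      exists_mem := fun m => ⟨1, by simp [F]⟩ }
  exact hasProjectiveDimensionLT_of_regular hx hR hreg n hF (zero_add n)
    fun i hi => absurd hi (Nat.not_lt_zero _)

end Dimension

end FilteredModule

/-! ### Ordered monomials and the degree filtration. -/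

namespace PBW

open FilteredModule

section Exponents

variable {n : ℕ}

/-- The total degree of an exponent vector. -/
def deg (a : Fin n → ℕ) : ℕ := ∑ i, a i

lemma deg_add (a b : Fin n → ℕ) : deg (a + b) = deg a + deg b := Finset.sum_add_distrib

@[simp] lemma deg_single (i : Fin n) : deg (Pi.single i 1) = 1 := by simp [deg]

@[simp] lemma deg_zero : deg (0 : Fin n → ℕ) = 0 := by simp [deg]

lemma le_deg (a : Fin n → ℕ) (i : Fin n) : a i ≤ deg a :=
  Finset.single_le_sum (fun _ _ => Nat.zero_le _) (Finset.mem_univ i)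

lemma exists_eq_add_single {a : Fin n → ℕ} {i : Fin n} (h : a i ≠ 0) :
    ∃ b : Fin n → ℕ, a = b + Pi.single i 1 := by
  refine ⟨a - Pi.single i 1, (tsub_add_cancel_of_le ?_).symm⟩
  intro j
  rcases eq_or_ne j i with rfl | hj
  · simpa using Nat.one_le_iff_ne_zero.2 h
  · simp [hj]

lemma exists_min_eq_add_single {a : Fin n → ℕ} {i : Fin n} (h : a i ≠ 0) :
    ∃ j ≤ i, ∃ b : Fin n → ℕ, (∀ l < j, b l = 0) ∧ a = b + Pi.single j 1 := by
  obtain ⟨j, hj, hmin⟩ := (wellFounded_lt (α := Fin n)).has_min {j | a j ≠ 0} ⟨i, h⟩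
  obtain ⟨b, hb⟩ := exists_eq_add_single hj
  refine ⟨j, not_lt.1 (hmin i h), b, fun l hl => ?_, hb⟩
  have : a l = 0 := by
    by_contra hne
    exact hmin l hne hl
  rw [hb] at this
  simpa [hl.ne] using this

/-- Induction on exponent vectors, adding variables on the left of an ordered monomial. -/
lemma exponent_induction {P : (Fin n → ℕ) → Prop} (zero : P 0)
    (add : ∀ i a, (∀ j < i, a j = 0) → P a → P (a + Pi.single i 1)) (a : Fin n → ℕ) : P a := by
  induction h : deg a using Nat.strong_induction_on generalizing a with
  | _ d ih =>
    by_cases ha : a = 0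
    · rwa [ha]
    · obtain ⟨i, hi⟩ := Function.ne_iff.1 ha
      obtain ⟨j, -, b, hb, rfl⟩ := exists_min_eq_add_single hi
      rw [deg_add, deg_single] at h
      exact add j b hb (ih (deg b) (by omega) b rfl)

end Exponents

section Monomials

variable {H : Type v} [Ring H] {n : ℕ}

/-- The ordered monomial with given exponents. -/
def ordered {n : ℕ} (x : Fin n → H) (a : Fin n → ℕ) : H := (List.ofFn fun i => x i ^ a i).prod

@[simp] lemma ordered_zero (x : Fin n → H) : ordered x 0 = 1 := by
  simp [ordered, List.ofFn_const]

lemma ordered_add_single (x : Fin n → H) {a : Fin n → ℕ} {i : Fin n} (h : ∀ j < i, a j = 0) :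
    ordered x (a + Pi.single i 1) = x i * ordered x a := by
  induction n with
  | zero => exact i.elim0
  | succ n ih =>
    simp only [ordered, List.ofFn_succ, List.prod_cons] at ih ⊢
    cases i using Fin.cases with
    | zero => simp [pow_succ', mul_assoc]
    | succ i =>
      have h0 : a 0 = 0 := h 0 (Fin.succ_pos i)
      have := ih (fun i => x i.succ) (a := fun j => a j.succ) (i := i)
        fun j hj => h j.succ (Fin.succ_lt_succ_iff.2 hj)
      simp only [Pi.add_apply, h0, pow_zero, one_mul] at this ⊢
      rw [← this]
      simp [Pi.single_apply, Fin.succ_inj]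

end Monomials

variable {K : Type u} {H : Type v} [Field K] [Ring H] [Algebra K H] {G : Type w} [Group G]
  {n : ℕ} {x : Fin n → H} {t : G →* H}

variable (K x t) in
/-- The elements `x i` and `t g` satisfy the relations of a quantum Drinfeld Hecke algebra. -/
structure Relations : Prop where
  act : ∀ g i, ∃ c : Fin n → K, t g * x i = ∑ j, c j • (x j * t g)
  comm : ∀ i j, ∃ c : K, c ≠ 0 ∧ x i * x j - c • (x j * x i) ∈ Submodule.span K (Set.range t)

variable (K t) in
/-- The span of the elements `t g`, as a subring. -/
def base : Subring H := (MonoidAlgebra.lift K H G t).range.toSubring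

lemma mem_base {s : H} : s ∈ base K t ↔ s ∈ Submodule.span K (Set.range t) := by
  rw [Finsupp.mem_span_range_iff_exists_finsupp]
  constructor
  · rintro ⟨f, rfl⟩
    exact ⟨f.coeff, (MonoidAlgebra.lift_apply t f).symm⟩
  · rintro ⟨f, rfl⟩
    exact ⟨MonoidAlgebra.ofCoeff f, MonoidAlgebra.lift_apply t _⟩

lemma algebraMap_mem_base (c : K) : algebraMap K H c ∈ base K t :=
  (MonoidAlgebra.lift K H G t).range.algebraMap_mem c

lemma group_mem_base (g : G) : t g ∈ base K t :=
  mem_base.2 (Submodule.subset_span ⟨g, rfl⟩)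

lemma smul_mem_of_base {M : Type*} [AddCommGroup M] [Module H M] (A : Submodule (base K t) M)
    (c : K) {m : M} (hm : m ∈ A) : algebraMap K H c • m ∈ A :=
  A.smul_mem ⟨_, algebraMap_mem_base c⟩ hm

lemma Relations.quasiCommuting (h : Relations K x t) : QuasiCommuting (base K t) x where
  comm := by
    intro i j
    obtain ⟨c, -, hc⟩ := h.comm i j
    refine ⟨algebraMap K H c, algebraMap_mem_base c, _, mem_base.2 hc, ?_⟩
    rw [← Algebra.commutes, ← Algebra.smul_def]
    abel
  act := by
    intro s hs i
    rw [mem_base] at hs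
    induction hs using Submodule.span_induction with
    | mem s hs =>
      obtain ⟨g, rfl⟩ := hs
      obtain ⟨c, hc⟩ := h.act g i
      refine ⟨fun j => algebraMap K H (c j) * t g,
        fun j => mul_mem (algebraMap_mem_base _) (group_mem_base g), ?_⟩
      rw [hc]
      refine Finset.sum_congr rfl fun j _ => ?_
      rw [← mul_assoc, ← Algebra.commutes, mul_assoc, Algebra.smul_def]
    | zero => exact ⟨0, fun _ => zero_mem _, by simp⟩
    | add a b _ _ ha hb =>
      obtain ⟨c, hc, h1⟩ := ha
      obtain ⟨d, hd, h2⟩ := hb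
      exact ⟨c + d, fun j => add_mem (hc j) (hd j), by
        simp [add_mul, mul_add, h1, h2, Finset.sum_add_distrib]⟩
    | smul a s _ hs =>
      obtain ⟨c, hc, h1⟩ := hs
      refine ⟨fun j => algebraMap K H a * c j, fun j => mul_mem (algebraMap_mem_base a) (hc j), ?_⟩
      rw [smul_mul_assoc, h1, Finset.smul_sum]
      refine Finset.sum_congr rfl fun j _ => ?_
      rw [← mul_assoc, ← Algebra.commutes, mul_assoc, Algebra.smul_def]

/-- The degree filtration of the algebra, shifted by one, as `K`-subspaces. -/
def fil (h : Relations K x t) (p : ℕ) : Submodule K H where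
  __ := (ringFiltration h.quasiCommuting p).toAddSubmonoid
  smul_mem' c m hm := by
    rw [Algebra.smul_def]
    exact smul_mem_of_base _ c hm

lemma mem_fil_iff {h : Relations K x t} {p : ℕ} {m : H} :
    m ∈ fil h p ↔ m ∈ ringFiltration h.quasiCommuting p := Iff.rfl

lemma fil_mono (h : Relations K x t) : Monotone (fil h) :=
  fun _ _ hpq => generated_mono h.quasiCommuting _ hpq

lemma gen_mul_mem_fil {h : Relations K x t} {p : ℕ} (i : Fin n) {m : H} (hm : m ∈ fil h p) :
    x i * m ∈ fil h (p + 1) := by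
  have : x i • m ∈ ringFiltration h.quasiCommuting (p + 1) :=
    smul_mem_generated h.quasiCommuting _ i (mem_fil_iff.1 hm)
  exact this

lemma base_mul_mem_fil {h : Relations K x t} {p : ℕ} {s m : H} (hs : s ∈ base K t)
    (hm : m ∈ fil h p) : s * m ∈ fil h p :=
  (ringFiltration h.quasiCommuting p).smul_mem ⟨s, hs⟩ hm

lemma base_mem_fil {h : Relations K x t} (p : ℕ) {s : H} (hs : s ∈ base K t) :
    s ∈ fil h (p + 1) :=
  mem_ringFiltration_one h.quasiCommuting p hs

/-- Induction along the recursive definition of the filtration. -/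
lemma fil_succ_induction {h : Relations K x t} {p : ℕ} {B : AddSubgroup H}
    (h0 : ∀ s ∈ base K t, s ∈ B) (h1 : ∀ m ∈ fil h p, m ∈ B)
    (h2 : ∀ i, ∀ m ∈ fil h p, x i * m ∈ B) : ∀ m ∈ fil h (p + 1), m ∈ B := by
  intro m hm
  obtain ⟨a, ha, b, hb, rfl⟩ := Submodule.mem_sup.1 (mem_fil_iff.1 hm)
  refine add_mem ?_ (initial_induction h1 (fun i _ m hm => h2 i m hm) hb)
  obtain ⟨s, rfl⟩ := Submodule.mem_span_singleton.1 ha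
  exact h0 _ (by simp [Subring.smul_def])

@[simp] lemma fil_zero (h : Relations K x t) : fil h 0 = ⊥ :=
  le_bot_iff.1 fun _ hm => hm

lemma fil_mul_base {h : Relations K x t} {p : ℕ} {m s : H} (hm : m ∈ fil h p)
    (hs : s ∈ base K t) : m * s ∈ fil h p := by
  induction p generalizing m with
  | zero =>
    rw [fil_zero, Submodule.mem_bot] at hm
    simp [hm]
  | succ p ih =>
    refine fil_succ_induction (B := (fil h (p + 1)).toAddSubgroup.comap (AddMonoidHom.mulRight s))
      ?_ ?_ ?_ m hm
    · exact fun r hr => base_mem_fil (h := h) p (mul_mem hr hs)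
    · exact fun m hm => fil_mono h (Nat.le_succ p) (ih hm)
    · intro i m hm
      change x i * m * s ∈ fil h (p + 1)
      rw [mul_assoc]
      exact gen_mul_mem_fil i (ih hm)

/-- The filtration is built by left multiplication; this right-hand version is what `op_mem_fil`
needs. -/
lemma fil_mul_gen {h : Relations K x t} {p : ℕ} {m : H} (hm : m ∈ fil h p) (i : Fin n) :
    m * x i ∈ fil h (p + 1) := by
  induction p generalizing m with
  | zero =>
    rw [fil_zero, Submodule.mem_bot] at hm
    simp [hm]
  | succ p ih =>
    refine fil_succ_induction
      (B := (fil h (p + 2)).toAddSubgroup.comap (AddMonoidHom.mulRight (x i))) ?_ ?_ ?_ m hm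
    · intro s hs
      obtain ⟨c, hc, e⟩ := h.quasiCommuting.act s hs i
      change s * x i ∈ fil h (p + 2)
      rw [e]
      exact sum_mem fun j _ => gen_mul_mem_fil j (base_mem_fil p (hc j))
    · exact fun m hm => fil_mono h (Nat.le_succ _) (ih hm)
    · intro j m hm
      change x j * m * x i ∈ fil h (p + 2)
      rw [mul_assoc]
      exact gen_mul_mem_fil j (ih hm)

lemma fil_mul_fil {h : Relations K x t} {p q : ℕ} {a b : H} (ha : a ∈ fil h q)
    (hb : b ∈ fil h (p + 1)) : a * b ∈ fil h (p + q) :=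
  ringFiltration_smul_mem h.quasiCommuting (generated_mono h.quasiCommuting _)
    (fun _ i _ hm => smul_mem_generated h.quasiCommuting _ i hm) ha hb

lemma ordered_mem_fil (h : Relations K x t) (a : Fin n → ℕ) :
    ordered x a ∈ fil h (deg a + 1) := by
  induction a using exponent_induction with
  | zero => simpa using base_mem_fil 0 (base K t).one_mem
  | add i a hi ih =>
    rw [ordered_add_single x hi, deg_add, deg_single]
    exact gen_mul_mem_fil i ih

/-- Multiplying an ordered monomial by a generator reorders up to a nonzero scalar and
terms of lower degree. -/
lemma exists_gen_mul_ordered (h : Relations K x t) (i : Fin n) (a : Fin n → ℕ) :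
    ∃ c : K, c ≠ 0 ∧
      x i * ordered x a - c • ordered x (a + Pi.single i 1) ∈ fil h (deg a + 1) := by
  induction a using exponent_induction generalizing i with
  | zero =>
    refine ⟨1, one_ne_zero, ?_⟩
    rw [ordered_add_single x (a := 0) fun _ _ => rfl, one_smul, sub_self]
    exact zero_mem _
  | add j a hj ih =>
    rcases le_or_gt i j with hij | hij
    · refine ⟨1, one_ne_zero, ?_⟩
      rw [ordered_add_single x (i := i), one_smul, sub_self]
      · exact zero_mem _
      · intro l hl
        simp [hj l (hl.trans_le hij), (hl.trans_le hij).ne]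
    · obtain ⟨c, hc, hy⟩ := ih i
      obtain ⟨d, hd, hs⟩ := h.comm i j
      refine ⟨d * c, mul_ne_zero hd hc, ?_⟩
      have e1 : ordered x (a + Pi.single j 1 + Pi.single i 1) =
          x j * ordered x (a + Pi.single i 1) := by
        rw [add_right_comm, ordered_add_single x]
        intro l hl
        simp [hj l hl, (hl.trans hij).ne]
      have e2 : x i * ordered x (a + Pi.single j 1) -
            (d * c) • ordered x (a + Pi.single j 1 + Pi.single i 1) =
          (x i * x j - d • (x j * x i)) * ordered x a +
            d • (x j * (x i * ordered x a - c • ordered x (a + Pi.single i 1))) := by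
        rw [e1, ordered_add_single x hj]
        simp only [sub_mul, mul_sub, smul_sub, smul_mul_assoc, mul_smul_comm, mul_assoc, mul_smul]
        abel
      rw [e2, deg_add, deg_single]
      exact add_mem (fil_mono h (Nat.le_succ _)
          (base_mul_mem_fil (mem_base.2 hs) (ordered_mem_fil h a)))
        (Submodule.smul_mem _ _ (gen_mul_mem_fil j hy))

variable (x t) in
/-- The monomial `x^a t_g`. -/
def mono (a : (Fin n → ℕ) × G) : H := ordered x a.1 * t a.2

lemma mono_mem_fil (h : Relations K x t) (a : (Fin n → ℕ) × G) :
    mono x t a ∈ fil h (deg a.1 + 1) :=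
  fil_mul_base (ordered_mem_fil h a.1) (group_mem_base a.2)

/-- The scalar is chosen before `g`, so that whole leading coefficient vectors in `G → K` are
rescaled, as `lead_mono_right` requires. -/
lemma exists_gen_mul_mono (h : Relations K x t) (i : Fin n) (a : Fin n → ℕ) :
    ∃ c : K, c ≠ 0 ∧ ∀ g,
      x i * mono x t (a, g) - c • mono x t (a + Pi.single i 1, g) ∈ fil h (deg a + 1) := by
  obtain ⟨c, hc, hy⟩ := exists_gen_mul_ordered h i a
  refine ⟨c, hc, fun g => ?_⟩
  have := fil_mul_base hy (group_mem_base g)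
  rwa [sub_mul, smul_mul_assoc, mul_assoc] at this

/-- Reordering costs only lower-degree terms. No linear independence enters, so the equality is also
available for the opposite algebra before its basis is known. -/
lemma fil_eq_span (h : Relations K x t) (p : ℕ) :
    fil h p = Submodule.span K (mono x t '' {a | deg a.1 < p}) := by
  refine le_antisymm ?_ (Submodule.span_le.2 ?_)
  · induction p with
    | zero => simp
    | succ p ih =>
      have hmono : Submodule.span K (mono x t '' {a | deg a.1 < p}) ≤
          Submodule.span K (mono x t '' {a | deg a.1 < p + 1}) :=
        Submodule.span_mono (Set.image_mono fun a (ha : deg a.1 < p) => Nat.lt_succ_of_lt ha)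
      refine fil_succ_induction
        (B := (Submodule.span K (mono x t '' {a | deg a.1 < p + 1})).toAddSubgroup) ?_ ?_ ?_
      · intro s hs
        refine Submodule.span_mono ?_ (mem_base.1 hs)
        rintro _ ⟨g, rfl⟩
        exact ⟨(0, g), by simp, by simp [mono]⟩
      · exact fun m hm => hmono (ih hm)
      · intro i m hm
        have : m ∈ (Submodule.span K (mono x t '' {a | deg a.1 < p + 1})).comap
            (LinearMap.mulLeft K (x i)) := by
          refine (Submodule.span_le.2 ?_ : Submodule.span K _ ≤ _) (ih hm)
          rintro _ ⟨⟨a, g⟩, ha, rfl⟩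
          obtain ⟨c, -, hc⟩ := exists_gen_mul_mono h i a
          change x i * mono x t (a, g) ∈
            Submodule.span K (mono x t '' {a | deg a.1 < p + 1})
          rw [← sub_add_cancel (x i * _) (c • mono x t (a + Pi.single i 1, g))]
          refine add_mem (hmono (ih (fil_mono h (show deg a + 1 ≤ p from ha) (hc g))))
            (Submodule.smul_mem _ _ (Submodule.subset_span ⟨_, ?_, rfl⟩))
          change deg (a + Pi.single i 1) < p + 1
          rw [deg_add, deg_single]
          exact Nat.succ_lt_succ ha
        exact this
  · rintro _ ⟨a, ha, rfl⟩
    exact fil_mono h (show deg a.1 + 1 ≤ p from ha) (mono_mem_fil h a)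

end PBW

/-! ### Regularity of the generators from the monomial basis. -/

namespace PBW

open FilteredModule

variable {K : Type u} {H : Type v} [Field K] [Ring H] [Algebra K H] {G : Type w} [Group G]
  {n : ℕ} {x : Fin n → H} {t : G →* H}

variable (K x t) in
/-- The relations hold and the monomials `x^a t_g` form a basis. -/
structure IsPBW : Prop extends Relations K x t where
  linearIndependent : LinearIndependent K (mono x t)
  span_eq_top : Submodule.span K (Set.range (mono x t)) = ⊤

lemma gen_mul_mem_initial {h : Relations K x t} {p k : ℕ} {m : H} (hm : m ∈ fil h p) (i : Fin n)
    (hi : (i : ℕ) < k) : x i * m ∈ initial x (ringFiltration h.quasiCommuting p) k := by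
  have : x i • m ∈ initial x (ringFiltration h.quasiCommuting p) k :=
    smul_mem_initial (mem_fil_iff.1 hm) i hi
  exact this

namespace IsPBW

variable (h : IsPBW K x t)
include h

/-- The basis of monomials. -/
def basis : Module.Basis ((Fin n → ℕ) × G) K H :=
  Module.Basis.mk h.linearIndependent h.span_eq_top.ge

@[simp] lemma basis_apply (a : (Fin n → ℕ) × G) : h.basis a = mono x t a :=
  Module.Basis.mk_apply _ _ a

lemma repr_mono (a : (Fin n → ℕ) × G) : h.basis.repr (mono x t a) = Finsupp.single a 1 := by
  rw [← h.basis_apply, Module.Basis.repr_self]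

lemma coe_basis : ⇑h.basis = mono x t := funext h.basis_apply

lemma mem_fil_iff_repr {p : ℕ} {m : H} :
    m ∈ fil h.toRelations p ↔ ∀ a, h.basis.repr m a ≠ 0 → deg a.1 < p := by
  rw [fil_eq_span, ← h.coe_basis, Module.Basis.mem_span_image]
  simp [Set.subset_def]

lemma repr_eq_zero {p : ℕ} {m : H} (hm : m ∈ fil h.toRelations p) {a : (Fin n → ℕ) × G}
    (ha : p ≤ deg a.1) : h.basis.repr m a = 0 := by
  by_contra hne
  exact absurd (h.mem_fil_iff_repr.1 hm a hne) (not_lt.2 ha)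

lemma exists_mem_fil (m : H) : ∃ p, m ∈ fil h.toRelations p := by
  refine ⟨(h.basis.repr m).support.sup (fun a => deg a.1 + 1), h.mem_fil_iff_repr.2 fun a ha => ?_⟩
  exact Nat.lt_of_succ_le (Finset.le_sup (f := fun a : (Fin n → ℕ) × G => deg a.1 + 1)
    (Finsupp.mem_support_iff.2 ha))

lemma isFiltration :
    IsFiltration (base K t) x (ringFiltration h.toRelations.quasiCommuting) where
  zero := rfl
  mono := fil_mono h.toRelations
  smul := fun _ i _ hm => gen_mul_mem_fil (h := h.toRelations) i hm
  exists_mem := h.exists_mem_fil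

/-- Every term of `x i * m` of degree `deg c` contains the variable `i`; reordering errors have
smaller degree. -/
lemma repr_gen_mul_of_eq_zero {i : Fin n} {c : Fin n → ℕ} (hc : c i = 0) (g : G) {m : H}
    (hm : m ∈ fil h.toRelations (deg c)) : h.basis.repr (x i * m) (c, g) = 0 := by
  rw [fil_eq_span] at hm
  induction hm using Submodule.span_induction with
  | mem m hm =>
    obtain ⟨⟨b, g'⟩, hb, rfl⟩ := hm
    obtain ⟨r, -, hr⟩ := exists_gen_mul_mono h.toRelations i b
    have h1 := h.repr_eq_zero (hr g') (a := (c, g)) hb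
    rw [map_sub, map_smul, h.repr_mono, Finsupp.sub_apply, sub_eq_zero] at h1
    rw [h1, Finsupp.smul_apply, Finsupp.single_eq_of_ne, smul_zero]
    rintro e
    rw [Prod.mk.injEq] at e
    simp [e.1] at hc
  | zero => simp
  | add a b _ _ ha hb => rw [mul_add, map_add, Finsupp.add_apply, ha, hb, add_zero]
  | smul r a _ ha => rw [mul_smul_comm, map_smul, Finsupp.smul_apply, ha, smul_zero]

lemma exists_repr_gen_mul (i : Fin n) (a : Fin n → ℕ) :
    ∃ r : K, r ≠ 0 ∧ ∀ g, ∀ m ∈ fil h.toRelations (deg a + 1),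
      h.basis.repr (x i * m) (a + Pi.single i 1, g) = r * h.basis.repr m (a, g) := by
  classical
  obtain ⟨r, hr0, hr⟩ := exists_gen_mul_mono h.toRelations i a
  refine ⟨r, hr0, fun g m hm => ?_⟩
  rw [fil_eq_span] at hm
  induction hm using Submodule.span_induction with
  | mem m hm =>
    obtain ⟨⟨b, g'⟩, hb, rfl⟩ := hm
    obtain ⟨s, -, hs⟩ := exists_gen_mul_mono h.toRelations i b
    have hb' : deg b + 1 ≤ deg (a + Pi.single i 1) := by
      rw [deg_add, deg_single]; exact hb
    by_cases hab : b = a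
    · subst hab
      have h1 := h.repr_eq_zero (hr g') (a := (b + Pi.single i 1, g)) hb'
      rw [map_sub, map_smul, h.repr_mono, Finsupp.sub_apply, sub_eq_zero] at h1
      rw [h1, h.repr_mono, Finsupp.smul_apply, smul_eq_mul, Finsupp.single_apply,
        Finsupp.single_apply]
      simp
    · have h1 := h.repr_eq_zero (hs g') (a := (a + Pi.single i 1, g)) hb'
      rw [map_sub, map_smul, h.repr_mono, Finsupp.sub_apply, sub_eq_zero] at h1
      rw [h1, h.repr_mono, Finsupp.smul_apply, Finsupp.single_eq_of_ne, Finsupp.single_eq_of_ne,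
        smul_zero, mul_zero]
      · rintro e
        exact hab (congrArg Prod.fst e).symm
      · rintro e
        exact hab (add_right_cancel (congrArg Prod.fst e)).symm
  | zero => simp
  | add a b _ _ ha hb => rw [mul_add, map_add, Finsupp.add_apply, ha, hb, map_add,
      Finsupp.add_apply, mul_add]
  | smul s a _ ha =>
      rw [mul_smul_comm, map_smul, Finsupp.smul_apply, ha, map_smul, Finsupp.smul_apply,
        smul_eq_mul, smul_eq_mul, mul_left_comm]

lemma repr_eq_zero_of_mem_initial {k p : ℕ} {m : H}
    (hm : m ∈ initial x (ringFiltration h.toRelations.quasiCommuting p) k) {c : Fin n → ℕ}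
    (hp : deg c = p) (hc : ∀ j : Fin n, (j : ℕ) < k → c j = 0) (g : G) :
    h.basis.repr m (c, g) = 0 := by
  subst hp
  refine initial_induction (B := (LinearMap.ker (h.basis.coord (c, g))).toAddSubgroup)
    (fun m hm => ?_) (fun i hi m hm => ?_) hm
  · exact h.repr_eq_zero (a := (c, g)) hm le_rfl
  · exact h.repr_gen_mul_of_eq_zero (hc i hi) g hm

/-- Converse to `repr_eq_zero_of_mem_initial`: in top degree, `initial` is the monomial ideal of the
first `k` variables. The least variable of a monomial can be split off on the left exactly. -/
lemma mem_initial_of_repr {k p : ℕ} {m : H} (hm : m ∈ fil h.toRelations (p + 1))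
    (h0 : ∀ c : Fin n → ℕ, deg c = p → (∀ j : Fin n, (j : ℕ) < k → c j = 0) →
      ∀ g, h.basis.repr m (c, g) = 0) :
    m ∈ initial x (ringFiltration h.toRelations.quasiCommuting p) k := by
  rw [← h.basis.linearCombination_repr m, Finsupp.linearCombination_apply]
  refine sum_mem ?_
  rintro ⟨a, g⟩ ha
  have ha := Finsupp.mem_support_iff.1 ha
  have hdeg := Nat.lt_succ_iff.1 (h.mem_fil_iff_repr.1 hm _ ha)
  beta_reduce
  rw [h.basis_apply]
  rcases hdeg.lt_or_eq with hlt | heq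
  · refine mem_initial_of_mem ((mem_fil_iff (h := h.toRelations)).1 ?_) k
    have hle : deg a + 1 ≤ p := hlt
    exact (fil h.toRelations p).smul_mem _
      (fil_mono h.toRelations hle (mono_mem_fil h.toRelations (a, g)))
  · have : ∃ j : Fin n, (j : ℕ) < k ∧ a j ≠ 0 := by
      by_contra! hcon
      exact ha (h0 a heq hcon g)
    obtain ⟨j, hj, hja⟩ := this
    obtain ⟨l, hl, b, hb, rfl⟩ := exists_min_eq_add_single hja
    change deg (b + Pi.single l 1) = p at heq
    rw [deg_add, deg_single] at heq
    have e : mono x t (b + Pi.single l 1, g) = x l * mono x t (b, g) := by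
      rw [mono, mono, ordered_add_single x hb, mul_assoc]
    have hb' : mono x t (b, g) ∈ fil h.toRelations p := by
      rw [← heq]
      exact mono_mem_fil h.toRelations (b, g)
    rw [e, ← mul_smul_comm]
    exact gen_mul_mem_initial ((fil h.toRelations p).smul_mem _ hb') l (lt_of_le_of_lt hl hj)

/-- If `c` avoids the variables before `i`, so does `c + Pi.single i 1`, and the two coefficients
differ by a nonzero scalar. -/
lemma regular : Regular x (ringFiltration h.toRelations.quasiCommuting) n := by
  intro i _ p m hm hxm
  refine h.mem_initial_of_repr hm fun c hc hci g => ?_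
  obtain ⟨r, hr, hmul⟩ := h.exists_repr_gen_mul i c
  have h1 := hmul g m (hc ▸ hm)
  have h2 := h.repr_eq_zero_of_mem_initial hxm (c := c + Pi.single i 1)
    (by rw [deg_add, deg_single, hc]) (fun j hj => by
      have : j ≠ i := fun e => by simp [e] at hj
      simp [hci j hj, this]) g
  rw [smul_eq_mul, h1] at h2
  exact (mul_eq_zero.1 h2).resolve_left hr

/-- In the non-modular case the left global dimension is at most the number of variables. -/
theorem leftGlobalDim_le [Finite G] (hG : (Nat.card G : K) ≠ 0) :
    QuantumDrinfeldHecke.leftGlobalDim H ≤ (n : WithBot ℕ∞) := by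
  have : NeZero (Nat.card G : K) := ⟨hG⟩
  -- The base is an image of the group algebra, which is semisimple by Maschke's theorem.
  have : IsSemisimpleRing (base K t) :=
    RingHom.isSemisimpleRing_of_surjective
      (MonoidAlgebra.lift K H G t).rangeRestrict.toRingHom
      (MonoidAlgebra.lift K H G t).rangeRestrict_surjective
  exact FilteredModule.leftGlobalDim_le h.toRelations.quasiCommuting h.isFiltration h.regular

end IsPBW

end PBW

/-! ### The opposite algebra. -/

namespace PBW

open FilteredModule MulOpposite

variable {K : Type u} {H : Type v} [Field K] [Ring H] [Algebra K H] {G : Type w} [Group G]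
  {n : ℕ} {x : Fin n → H} {t : G →* H}

section Opposite

/-- The group elements `t g⁻¹` in the opposite ring. -/
def opHom (t : G →* H) : G →* Hᵐᵒᵖ where
  toFun g := op (t g⁻¹)
  map_one' := by simp
  map_mul' g h := by simp

lemma op_mem_span {s : H} (hs : s ∈ Submodule.span K (Set.range t)) :
    op s ∈ Submodule.span K (Set.range (opHom t)) := by
  induction hs using Submodule.span_induction with
  | mem s hs =>
    obtain ⟨g, rfl⟩ := hs
    exact Submodule.subset_span ⟨g⁻¹, by simp [opHom]⟩
  | zero => exact zero_mem _
  | add a b _ _ ha hb => exact add_mem ha hb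
  | smul c a _ ha => exact Submodule.smul_mem _ c ha

lemma Relations.opposite (h : Relations K x t) : Relations K (fun i => op (x i)) (opHom t) where
  act := by
    intro g i
    obtain ⟨c, hc⟩ := h.act g i
    refine ⟨c, ?_⟩
    have e : x i * t g⁻¹ = ∑ j, c j • (t g⁻¹ * x j) := by
      calc x i * t g⁻¹ = t g⁻¹ * (t g * x i) * t g⁻¹ := by
            rw [← mul_assoc, ← map_mul, inv_mul_cancel, map_one, one_mul]
        _ = _ := by
            rw [hc]
            simp [Finset.mul_sum, Finset.sum_mul, mul_assoc, ← map_mul]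
    have := congrArg op e
    simpa [opHom] using this
  comm := by
    intro i j
    obtain ⟨c, hc, hs⟩ := h.comm j i
    exact ⟨c, hc, op_mem_span hs⟩

lemma op_mem_fil (h : Relations K x t) {p : ℕ} {m : H} (hm : m ∈ fil h p) :
    op m ∈ fil h.opposite p := by
  induction p generalizing m with
  | zero =>
    rw [fil_zero, Submodule.mem_bot] at hm
    simp [hm]
  | succ p ih =>
    refine fil_succ_induction
      (B := (fil h.opposite (p + 1)).toAddSubgroup.comap (opAddEquiv (α := H)).toAddMonoidHom)
      ?_ ?_ ?_ m hm
    · exact fun s hs => base_mem_fil (h := h.opposite) p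
        (mem_base.2 (op_mem_span (mem_base.1 hs)))
    · exact fun m hm => fil_mono _ (Nat.le_succ p) (ih hm)
    · exact fun i m hm => fil_mul_gen (h := h.opposite) (ih hm) i

lemma finite_deg_lt {G : Type*} [Finite G] (p : ℕ) : {a : (Fin n → ℕ) × G | deg a.1 < p}.Finite := by
  refine ((Set.Finite.pi' fun _ : Fin n => Set.finite_Iio p).prod
    (Set.finite_univ (α := G))).subset fun a (ha : deg a.1 < p) => ⟨fun i => ?_, trivial⟩
  exact (le_deg a.1 i).trans_lt ha

instance [Finite G] (h : Relations K x t) (p : ℕ) : FiniteDimensional K (fil h p) := by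
  rw [fil_eq_span]
  exact FiniteDimensional.span_of_finite K ((finite_deg_lt p).image _)

/-- The opposite algebra again has a basis of ordered monomials. -/
lemma IsPBW.opposite [Finite G] (h : IsPBW K x t) :
    IsPBW K (fun i => op (x i)) (opHom t) where
  toRelations := h.toRelations.opposite
  linearIndependent := by
    have huniv : (⋃ p : ℕ, {a : (Fin n → ℕ) × G | deg a.1 < p}) = Set.univ :=
      Set.eq_univ_of_forall fun a => Set.mem_iUnion.2 ⟨deg a.1 + 1, Nat.lt_succ_self _⟩
    rw [← linearIndepOn_univ_iff, ← huniv]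
    refine linearIndepOn_iUnion_of_directed (Monotone.directed_le
      fun p q hpq a (ha : deg a.1 < p) => ha.trans_le hpq) fun p => ?_
    have hfin : Fintype {a : (Fin n → ℕ) × G | deg a.1 < p} := (finite_deg_lt p).fintype
    -- Independence by counting: the opposite filtration contains the image of the original one,
    -- whose dimension is the number of monomials of degree below `p`.
    refine linearIndependent_iff_card_le_finrank_span.2 ?_
    rw [← Set.image_eq_range, Set.finrank, ← fil_eq_span h.toRelations.opposite]
    have hli : LinearIndependent K fun a : {a : (Fin n → ℕ) × G | deg a.1 < p} => mono x t a :=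
      h.linearIndependent.comp _ Subtype.val_injective
    have hcard := finrank_span_eq_card hli
    rw [← Set.image_eq_range, ← fil_eq_span h.toRelations] at hcard
    rw [← hcard, ← (opLinearEquiv K (M := H)).finrank_map_eq (fil h.toRelations p)]
    refine Submodule.finrank_mono ?_
    rintro _ ⟨m, hm, rfl⟩
    exact op_mem_fil h.toRelations hm
  span_eq_top := by
    refine eq_top_iff.2 fun m _ => ?_
    obtain ⟨p, hp⟩ := h.exists_mem_fil (unop m)
    have := op_mem_fil h.toRelations hp
    rw [fil_eq_span] at this
    exact Submodule.span_mono (Set.image_subset_range _ _) this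

end Opposite

lemma group_eq_mono (x : Fin n → H) (t : G →* H) (g : G) : t g = mono x t (0, g) := by
  simp [mono]

/-! ### Leading terms: the Noetherian property and zero divisors. -/

section Order

/-- The key of the degree-lexicographic order on exponent vectors. -/
def key (a : Fin n → ℕ) : ℕ ×ₗ Lex (Fin n → ℕ) := toLex (deg a, toLex a)

lemma key_injective : Function.Injective (key (n := n)) := fun _ _ h =>
  toLex.injective (congrArg Prod.snd (toLex.injective h))

lemma key_add (a b : Fin n → ℕ) : key (a + b) = key a + key b := by
  rw [key, deg_add]; rfl

lemma key_add_lt {a b : Fin n → ℕ} (c : Fin n → ℕ) : key (a + c) < key (b + c) ↔ key a < key b := by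
  rw [key_add, key_add, add_lt_add_iff_right]

/-- Degree is compared first so that the lower-degree errors of reordering never disturb a leading
term. -/
lemma deg_le_of_key_le {a b : Fin n → ℕ} (h : key a ≤ key b) : deg a ≤ deg b := by
  rcases Prod.Lex.toLex_le_toLex.1 h with h | h
  · exact h.le
  · exact h.1.le

namespace IsPBW

variable (h : IsPBW K x t)
include h

/-- All monomials occurring in `m` are at most `a` in the degree-lexicographic order. -/
def Below (m : H) (a : Fin n → ℕ) : Prop :=
  ∀ b g, key a < key b → h.basis.repr m (b, g) = 0

variable {h}

lemma Below.mem_fil {m : H} {a : Fin n → ℕ} (hm : h.Below m a) {p : ℕ} (hp : deg a < p) :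
    m ∈ fil h.toRelations p := by
  refine h.mem_fil_iff_repr.2 fun b hb => ?_
  have : ¬ key a < key b.1 := fun hlt => hb (hm b.1 b.2 hlt)
  exact (deg_le_of_key_le (not_lt.1 this)).trans_lt hp

lemma Below.gen_mul {m : H} {a : Fin n → ℕ} (hm : h.Below m a) (i : Fin n) :
    h.Below (x i * m) (a + Pi.single i 1) := by
  intro c g hc
  have hdeg := deg_le_of_key_le hc.le
  rw [deg_add, deg_single] at hdeg
  by_cases hci : c i = 0
  · exact h.repr_gen_mul_of_eq_zero hci g (hm.mem_fil hdeg)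
  · obtain ⟨b, rfl⟩ := exists_eq_add_single hci
    rw [deg_add, deg_single] at hdeg
    obtain ⟨r, -, hr⟩ := h.exists_repr_gen_mul i b
    rw [hr g m (hm.mem_fil hdeg), hm b g ((key_add_lt _).1 hc), mul_zero]

variable (h) in
lemma exists_ordered_mul (a b : Fin n → ℕ) : ∃ r : K, r ≠ 0 ∧ ∀ m, h.Below m b →
    h.Below (ordered x a * m) (a + b) ∧
      ∀ g, h.basis.repr (ordered x a * m) (a + b, g) = r * h.basis.repr m (b, g) := by
  induction a using exponent_induction with
  | zero => exact ⟨1, one_ne_zero, fun m hm => by simpa using hm⟩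
  | add i a hi ih =>
    obtain ⟨r, hr, hmul⟩ := ih
    obtain ⟨s, hs, hgen⟩ := h.exists_repr_gen_mul i (a + b)
    refine ⟨s * r, mul_ne_zero hs hr, fun m hm => ?_⟩
    obtain ⟨h1, h2⟩ := hmul m hm
    rw [ordered_add_single x hi, mul_assoc, add_right_comm]
    refine ⟨h1.gen_mul i, fun g => ?_⟩
    rw [hgen g _ (h1.mem_fil (Nat.lt_succ_self _)), h2, mul_assoc]

variable (h) in
lemma exists_lead {m : H} (hm : m ≠ 0) :
    ∃ a, h.Below m a ∧ ∃ g, h.basis.repr m (a, g) ≠ 0 := by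
  have hne : (h.basis.repr m).support.Nonempty := by
    simpa [Finsupp.support_nonempty_iff] using hm
  obtain ⟨⟨a, g⟩, ha, hmax⟩ := Finset.exists_max_image _ (fun b => key b.1) hne
  refine ⟨a, fun b g' hb => ?_, g, Finsupp.mem_support_iff.1 ha⟩
  by_contra hcon
  exact absurd (hmax (b, g') (Finsupp.mem_support_iff.2 hcon)) (not_le.2 hb)

variable (h) in
/-- The leading coefficients at `a` of the elements of a left ideal. -/
def lead (L : Submodule H H) (a : Fin n → ℕ) : Submodule K (G → K) where
  carrier := {c | ∃ m ∈ L, h.Below m a ∧ ∀ g, h.basis.repr m (a, g) = c g}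
  add_mem' := by
    rintro c d ⟨m, hm, h1, h2⟩ ⟨l, hl, h3, h4⟩
    exact ⟨m + l, add_mem hm hl, fun b g hb => by simp [h1 b g hb, h3 b g hb],
      fun g => by simp [h2, h4]⟩
  zero_mem' := ⟨0, zero_mem _, fun b g _ => by simp, fun g => by simp⟩
  smul_mem' := by
    rintro r c ⟨m, hm, h1, h2⟩
    refine ⟨r • m, ?_, fun b g hb => by simp [h1 b g hb], fun g => by simp [h2]⟩
    rw [Algebra.smul_def]
    exact L.smul_mem _ hm

lemma lead_mono_left {L L' : Submodule H H} (hL : L ≤ L') (a : Fin n → ℕ) :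
    h.lead L a ≤ h.lead L' a := by
  rintro c ⟨m, hm, h1, h2⟩
  exact ⟨m, hL hm, h1, h2⟩

/-- Left multiplication by the monomial with exponents `b - a` moves leading vectors from `a` to `b`
up to one nonzero scalar. -/
lemma lead_mono_right (L : Submodule H H) : Monotone (h.lead L) := by
  intro a b hab c ⟨m, hm, h1, h2⟩
  obtain ⟨r, hr, hmul⟩ := h.exists_ordered_mul (b - a) a
  obtain ⟨h3, h4⟩ := hmul m h1
  rw [tsub_add_cancel_of_le hab] at h3 h4
  have : r • c ∈ h.lead L b :=
    ⟨_, L.smul_mem (ordered x (b - a)) hm, h3, fun g => by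
      rw [smul_eq_mul, h4, h2, Pi.smul_apply, smul_eq_mul]⟩
  simpa [smul_smul, inv_mul_cancel₀ hr] using (h.lead L b).smul_mem r⁻¹ this

/-- Division: subtract an element of `L` with the same leading vector, then use well-foundedness of
the order. -/
lemma le_of_lead_le {L L' : Submodule H H} (hL : L ≤ L')
    (hlead : ∀ a, h.lead L' a ≤ h.lead L a) : L' ≤ L := by
  have key_ind : ∀ a : Fin n → ℕ, ∀ m ∈ L', h.Below m a → m ∈ L := by
    intro a
    induction a using (InvImage.wf key wellFounded_lt).induction with
    | _ a ih =>
      intro m hm hma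
      obtain ⟨l, hl, h1, h2⟩ := hlead a ⟨m, hm, hma, fun _ => rfl⟩
      suffices m - l ∈ L by simpa using add_mem this hl
      by_cases h0 : m - l = 0
      · rw [h0]; exact zero_mem _
      obtain ⟨b, hb, g, hg⟩ := h.exists_lead h0
      refine ih b ?_ (m - l) (sub_mem hm (hL hl)) hb
      change key b < key a
      rcases lt_trichotomy (key b) (key a) with hlt | heq | hgt
      · exact hlt
      · rw [key_injective heq] at hg
        exact absurd (by simp [h2]) hg
      · exact absurd (by simp [hma b g hgt, h1 b g hgt]) hg
  intro m hm
  by_cases h0 : m = 0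
  · rw [h0]; exact zero_mem _
  obtain ⟨a, ha, -⟩ := h.exists_lead h0
  exact key_ind a m hm ha

variable (h) in
/-- The algebra is left Noetherian. -/
theorem isNoetherianRing [Finite G] : IsNoetherianRing H := by
  rw [IsNoetherianRing, isNoetherian_iff, wellFounded_iff_isEmpty_descending_chain]
  refine ⟨fun ⟨L, hL⟩ => ?_⟩
  have hL : ∀ k, L k < L (k + 1) := hL
  have hLmono : StrictMono L := strictMono_nat_of_lt_succ hL
  have hex : ∀ k, ∃ a, h.lead (L k) a < h.lead (L (k + 1)) a := by
    intro k
    by_contra! hcon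
    refine (hL k).not_ge (le_of_lead_le (h := h) (hL k).le fun a => ?_)
    by_contra hne
    exact hcon a (lt_of_le_not_ge (lead_mono_left (h := h) (hL k).le a) hne)
  choose a ha using hex
  -- Dickson's lemma: along a subsequence the exponents where the leading space grows are
  -- increasing, so the growth accumulates in the single finite-dimensional space `G → K`.
  obtain ⟨e, he⟩ := (wellQuasiOrdered_le (α := Fin n → ℕ)).exists_monotone_subseq a
  have hchain : ∀ k, h.lead (L (e k)) (a (e k)) < h.lead (L (e (k + 1))) (a (e (k + 1))) := by
    intro k
    refine (ha (e k)).trans_le ((lead_mono_left (h := h) (hLmono.monotone ?_) _).trans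
      (lead_mono_right (h := h) _ (he k (k + 1) (Nat.le_succ k))))
    exact Nat.succ_le_of_lt (e.strictMono (Nat.lt_succ_self k))
  have hwf := isNoetherian_iff.1 (inferInstance : IsNoetherian K (G → K))
  rw [wellFounded_iff_isEmpty_descending_chain] at hwf
  exact hwf.false ⟨_, hchain⟩

variable (h) in
lemma nontrivial : Nontrivial H :=
  ⟨⟨1, 0, by
    have := h.linearIndependent.ne_zero (0, 1)
    rwa [← group_eq_mono x t, map_one] at this⟩⟩

variable (h) in
lemma isDomain_of_subsingleton [Subsingleton G] : IsDomain H := by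
  have := h.nontrivial
  have : NoZeroDivisors H := by
    refine ⟨fun {a b} hab => ?_⟩
    by_contra! hne
    obtain ⟨c, hc, g, hcg⟩ := h.exists_lead hne.1
    obtain ⟨d, hd, g', hdg⟩ := h.exists_lead hne.2
    obtain rfl := Subsingleton.elim g 1
    obtain rfl := Subsingleton.elim g' 1
    obtain ⟨r, hr, hmul⟩ := h.exists_ordered_mul c d
    -- Terms of `a` below `c` cannot reach the exponent `c + d`, so only the leading term
    -- contributes.
    have hsum : h.basis.repr (a * b) (c + d, 1) =
        h.basis.repr a (c, 1) * h.basis.repr (mono x t (c, 1) * b) (c + d, 1) := by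
      conv_lhs => rw [← h.basis.linearCombination_repr a, Finsupp.linearCombination_apply]
      rw [Finsupp.sum, Finset.sum_mul, map_sum, Finsupp.finsetSum_apply,
        Finset.sum_eq_single_of_mem (c, 1) (Finsupp.mem_support_iff.2 hcg)]
      · simp
      · rintro ⟨e, g⟩ he hne
        obtain rfl := Subsingleton.elim g 1
        have hec : key e < key c := by
          refine lt_of_le_of_ne (not_lt.1 fun hlt => ?_) fun heq => ?_
          · exact Finsupp.mem_support_iff.1 he (hc e 1 hlt)
          · exact hne (by rw [key_injective heq])
        obtain ⟨s, -, hs⟩ := h.exists_ordered_mul e d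
        have := (hs b hd).1 (c + d) 1 ((key_add_lt d).2 hec)
        simp [mono, this]
    rw [hab, map_zero, mono, map_one, mul_one, (hmul b hd).2] at hsum
    exact mul_ne_zero hcg (mul_ne_zero hr hdg) hsum.symm
  exact NoZeroDivisors.to_isDomain H

variable (h) in
lemma subsingleton_of_isDomain [Finite G] [IsDomain H] : Subsingleton G := by
  classical
  have := Fintype.ofFinite G
  refine subsingleton_of_forall_eq 1 fun g => ?_
  have hmul : (t g - 1) * ∑ k, t k = 0 := by
    rw [sub_mul, one_mul, Finset.mul_sum, sub_eq_zero]
    simp_rw [← map_mul]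
    exact Fintype.sum_equiv (Equiv.mulLeft g) _ _ fun _ => rfl
  rcases mul_eq_zero.1 hmul with h0 | h0
  · have h1 : mono x t (0, g) = mono x t (0, 1) := by
      rwa [← group_eq_mono x t, ← group_eq_mono x t, map_one, ← sub_eq_zero]
    exact congrArg Prod.snd (h.linearIndependent.injective h1)
  -- The sum of the `t k` has coefficient `1` at the identity, so it is nonzero in every
  -- characteristic.
  · have h1 := congrArg (fun m => h.basis.repr m (0, 1)) h0
    simp only [group_eq_mono x t, map_sum, h.repr_mono, Finsupp.finsetSum_apply, map_zero,
      Finsupp.single_apply] at h1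
    simp at h1

variable (h) in
/-- The algebra is a domain exactly when the group is trivial. -/
theorem isDomain_iff [Finite G] : IsDomain H ↔ Subsingleton G :=
  ⟨fun _ => h.subsingleton_of_isDomain, fun _ => h.isDomain_of_subsingleton⟩

end IsPBW

end Order

end PBW

/-! ### Gelfand-Kirillov dimension. -/

namespace PBW

open Filter Topology QuantumDrinfeldHecke

variable {K : Type u} {H : Type v} [Field K] [Ring H] [Algebra K H] {G : Type w} [Group G]
  {n : ℕ} {x : Fin n → H} {t : G →* H}

section GelfandKirillov

lemma gkDim_self (K : Type u) [Field K] : gkDim K K = 0 := by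
  have h1 : (1 : Submodule K K) = ⊤ :=
    eq_top_iff.2 fun c _ => Submodule.mem_one.2 ⟨c, rfl⟩
  have h (W : Submodule K K) (m : ℕ) : Module.finrank K ((1 ⊔ W) ^ m : Submodule K K) = 1 := by
    have : (1 ⊔ W : Submodule K K) = 1 := by rw [h1, top_sup_eq]
    rw [this, one_pow, h1, finrank_top, Module.finrank_self]
  simp [gkDim, h]

lemma fg_one : (1 : Submodule K H).FG := by
  rw [Submodule.one_eq_span]
  exact Submodule.fg_span_singleton 1

lemma ofFn_prod_mem_pow {A : Submodule K H} {k : ℕ} {f : Fin k → H} (hf : ∀ i, f i ∈ A) :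
    (List.ofFn f).prod ∈ A ^ k := by
  induction k with
  | zero => simpa using Submodule.one_le.1 (le_refl (1 : Submodule K H))
  | succ k ih =>
    rw [List.ofFn_succ, List.prod_cons, pow_succ']
    exact Submodule.mul_mem_mul (hf 0) (ih fun i => hf i.succ)

lemma finrank_fil_le [Finite G] (h : Relations K x t) (p : ℕ) :
    Module.finrank K (fil h p) ≤ Nat.card G * p ^ n := by
  have := Fintype.ofFinite G
  let f : (Fin n → Fin p) × G → H := fun a => mono x t (fun i => a.1 i, a.2)
  have hle : fil h p ≤ Submodule.span K (Set.range f) := by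
    rw [fil_eq_span]
    refine Submodule.span_mono ?_
    rintro _ ⟨a, ha, rfl⟩
    exact ⟨(fun i => ⟨a.1 i, (le_deg a.1 i).trans_lt ha⟩, a.2), rfl⟩
  have := FiniteDimensional.span_of_finite K (Set.finite_range f)
  refine (Submodule.finrank_mono hle).trans ((finrank_range_le_card f).trans ?_)
  simp [mul_comm]

lemma pow_le_fil (h : Relations K x t) {A : Submodule K H} {d : ℕ} (hA : A ≤ fil h (d + 1))
    (m : ℕ) : A ^ m ≤ fil h (d * m + 1) := by
  induction m with
  | zero =>
    rw [pow_zero, Submodule.one_le]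
    exact base_mem_fil _ (base K t).one_mem
  | succ m ih =>
    rw [pow_succ, Submodule.mul_le]
    intro a ha b hb
    have := fil_mul_fil (ih ha) (hA hb)
    rwa [show d + (d * m + 1) = d * (m + 1) + 1 by ring] at this

lemma limsup_logb_le {f : ℕ → ℕ} {C D k : ℕ} (hf : ∀ m, f m ≤ C * (D * m + 1) ^ k) :
    limsup (fun m : ℕ => ((Real.logb m (f m) : ℝ) : EReal)) atTop ≤ k := by
  -- The added ones ensure `c ≥ 1`, which covers the case `f m = 0`, where the logarithm takes the
  -- value `0`.
  let c : ℝ := (C + 1) * (D + 1) ^ k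
  have hc : 1 ≤ c := by
    refine one_le_mul_of_one_le_of_one_le ?_ (one_le_pow₀ ?_) <;>
      exact le_add_of_nonneg_left (Nat.cast_nonneg _)
  have hbound : ∀ m : ℕ, 2 ≤ m → Real.logb m (f m) ≤ Real.log c / Real.log m + k := by
    intro m hm
    have hm1 : (1 : ℝ) < m := by exact_mod_cast hm
    have hle : (f m : ℝ) ≤ c * m ^ k := by
      have h1 : (f m : ℝ) ≤ C * (D * m + 1) ^ k := by exact_mod_cast hf m
      have h2 : (D * m + 1 : ℝ) ≤ (D + 1) * m := by linarith
      calc (f m : ℝ) ≤ C * (D * m + 1) ^ k := h1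
        _ ≤ (C + 1) * ((D + 1) * m) ^ k := by gcongr; linarith
        _ = c * m ^ k := by rw [mul_pow, ← mul_assoc]
    have heq : Real.logb m (c * m ^ k) = Real.log c / Real.log m + k := by
      rw [Real.logb_mul (by positivity) (by positivity), Real.logb_pow,
        Real.logb_self_eq_one hm1, mul_one, Real.logb]
    rw [← heq]
    rcases Nat.eq_zero_or_pos (f m) with h0 | hpos
    · rw [h0, Nat.cast_zero, Real.logb_zero]
      exact Real.logb_nonneg hm1 (one_le_mul_of_one_le_of_one_le hc (one_le_pow₀ hm1.le))
    · exact Real.logb_le_logb_of_le hm1 (by exact_mod_cast hpos) hle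
  have hlim : Tendsto (fun m : ℕ => ((Real.log c / Real.log m + k : ℝ) : EReal)) atTop
      (𝓝 ((k : ℝ) : EReal)) := by
    refine (continuous_coe_real_ereal.tendsto _).comp ?_
    have h0 : Tendsto (fun m : ℕ => Real.log c / Real.log m) atTop (𝓝 0) :=
      (Real.tendsto_log_atTop.comp tendsto_natCast_atTop_atTop).const_div_atTop _
    simpa using h0.add_const (k : ℝ)
  calc limsup (fun m : ℕ => ((Real.logb m (f m) : ℝ) : EReal)) atTop
      ≤ limsup (fun m : ℕ => ((Real.log c / Real.log m + k : ℝ) : EReal)) atTop :=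
        limsup_le_limsup ((eventually_ge_atTop 2).mono fun m hm =>
          EReal.coe_le_coe_iff.2 (hbound m hm))
    _ = k := by rw [hlim.limsup_eq]; simp

lemma le_limsup_logb {f : ℕ → ℕ} {k : ℕ} (hf : ∀ m, (m + 1) ^ k ≤ f m) :
    (k : EReal) ≤ limsup (fun m : ℕ => ((Real.logb m (f m) : ℝ) : EReal)) atTop := by
  have hbound : ∀ m : ℕ, 2 ≤ m → (k : ℝ) ≤ Real.logb m (f m) := by
    intro m hm
    have hm1 : (1 : ℝ) < m := by exact_mod_cast hm
    rw [Real.le_logb_iff_rpow_le hm1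
      (by exact_mod_cast (pow_pos (Nat.succ_pos m) k).trans_le (hf m)), Real.rpow_natCast]
    exact_mod_cast (Nat.pow_le_pow_left (Nat.le_succ m) k).trans (hf m)
  calc (k : EReal) = limsup (fun _ : ℕ => ((k : ℝ) : EReal)) atTop := by simp
    _ ≤ _ := limsup_le_limsup ((eventually_ge_atTop 2).mono fun m hm =>
          EReal.coe_le_coe_iff.2 (hbound m hm))

namespace IsPBW

lemma exists_le_fil (h : IsPBW K x t) {W : Submodule K H} (hW : W.FG) :
    ∃ d, W ≤ fil h.toRelations (d + 1) := by
  obtain ⟨s, rfl⟩ := hW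
  choose d hd using h.exists_mem_fil
  refine ⟨s.sup d, Submodule.span_le.2 fun w hw => fil_mono h.toRelations ?_ (hd w)⟩
  exact (Finset.le_sup (Finset.mem_coe.1 hw)).trans (Nat.le_succ _)

lemma le_finrank_pow (h : IsPBW K x t) {W : Submodule K H} (hfg : W.FG)
    (hW : (1 ⊔ Submodule.span K (Set.range x)) ^ n ≤ W) (m : ℕ) :
    (m + 1) ^ n ≤ Module.finrank K ((1 ⊔ W) ^ m : Submodule K H) := by
  let f : (Fin n → Fin (m + 1)) → H := fun a => mono x t (fun i => a i, 1)
  have hli : LinearIndependent K f := by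
    refine h.linearIndependent.comp
      (fun a : Fin n → Fin (m + 1) => ((fun i => (a i : ℕ)), (1 : G))) fun a b hab => ?_
    exact funext fun i => Fin.ext (congrFun (congrArg Prod.fst hab) i)
  have hcard := finrank_span_eq_card hli
  rw [Fintype.card_fun, Fintype.card_fin, Fintype.card_fin] at hcard
  have : FiniteDimensional K ((1 ⊔ W) ^ m : Submodule K H) :=
    Module.Finite.iff_fg.2 (((fg_one).sup hfg).pow m)
  rw [← hcard]
  refine Submodule.finrank_mono (Submodule.span_le.2 ?_)
  rintro _ ⟨a, rfl⟩
  have hX : (1 : Submodule K H) ≤ 1 ⊔ Submodule.span K (Set.range x) := le_sup_left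
  have hmem : ordered x (fun i => a i) ∈
      ((1 ⊔ Submodule.span K (Set.range x) : Submodule K H) ^ m) ^ n := by
    refine ofFn_prod_mem_pow fun i => ?_
    exact pow_le_pow_right' hX (Nat.lt_succ_iff.1 (a i).2)
      (Submodule.pow_mem_pow _ (Submodule.mem_sup_right (Submodule.subset_span (Set.mem_range_self i))) _)
  -- Exchanging the two exponents puts every monomial with exponents at most `m` in the `m`-th power
  -- of one fixed space; the monomials with `g = 1` suffice.
  rw [← pow_mul, mul_comm, pow_mul] at hmem
  have e : f a = ordered x (fun i => a i) := by simp [f, mono]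
  rw [SetLike.mem_coe, e]
  exact pow_le_pow_left' (hW.trans le_sup_right) m hmem

/-- The Gelfand-Kirillov dimension is the number of variables. -/
theorem gkDim_eq [Finite G] (h : IsPBW K x t) : gkDim K H = (n : EReal) + gkDim K K := by
  rw [gkDim_self, add_zero]
  refine le_antisymm (iSup_le fun W => ?_) ?_
  · obtain ⟨d, hd⟩ := h.exists_le_fil W.2
    have hle : 1 ⊔ W.1 ≤ fil h.toRelations (d + 1) :=
      sup_le (Submodule.one_le.2 (base_mem_fil _ (base K t).one_mem)) hd
    exact limsup_logb_le fun m =>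
      (Submodule.finrank_mono (pow_le_fil h.toRelations hle m)).trans (finrank_fil_le _ _)
  · have hfg : ((1 ⊔ Submodule.span K (Set.range x) : Submodule K H) ^ n).FG :=
      (fg_one.sup (Submodule.fg_span (Set.finite_range x))).pow n
    exact (le_limsup_logb (h.le_finrank_pow hfg le_rfl)).trans
      (le_iSup (fun W : {W : Submodule K H // W.FG} => limsup (fun m : ℕ =>
        ((Real.logb m (Module.finrank K ((1 ⊔ W.1) ^ m : Submodule K H)) : ℝ) : EReal)) atTop)
        ⟨_, hfg⟩)

end IsPBW

end GelfandKirillov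

end PBW

/-! ### From the presentation to the abstract relations. -/

namespace QuantumDrinfeldHecke

variable {K : Type u} {V : Type v} [Field K] [AddCommGroup V] [Module K V] {n : ℕ}
  {G : Subgroup (LinearMap.GeneralLinearGroup K V)} {b : Module.Basis (Fin n) K V}
  {q : Fin n → Fin n → K} {κ : Fin n → Fin n → MonoidAlgebra K G}

lemma toHecke_rel {y z : Free K n G} (h : Rel G b q κ y z) :
    toHecke G b q κ y = toHecke G b q κ z :=
  RingQuot.mkAlgHom_rel K h

variable (b q κ) in
/-- The group elements in the quantum Drinfeld Hecke algebra. -/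
def groupHom : G →* Hecke G b q κ where
  toFun g := toHecke G b q κ (genT G n g)
  map_one' := (toHecke_rel Rel.one).trans (map_one _)
  map_mul' g h := by rw [← map_mul, toHecke_rel (Rel.mul g h)]

lemma vec_basis (i : Fin n) : vec G b (b i) = genV G i := by
  simp [vec, Finsupp.single_apply]

lemma IsQuantumDrinfeldHecke.isPBW (hq : ∀ i j, q i j ≠ 0)
    (hH : IsQuantumDrinfeldHecke G b q κ) :
    PBW.IsPBW K (fun i => toHecke G b q κ (genV G i)) (groupHom b q κ) := by
  have hmono : PBW.mono (fun i => toHecke G b q κ (genV G i)) (groupHom b q κ) =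
      monomial G b q κ := by
    funext a
    simp [PBW.mono, PBW.ordered, monomial, groupHom, map_list_prod, List.map_ofFn,
      Function.comp_def]
  refine { act := fun g i => ?_, comm := fun i j => ?_, linearIndependent := ?_,
           span_eq_top := ?_ }
  · refine ⟨fun j => b.repr (g.1.1 (b i)) j, ?_⟩
    have := toHecke_rel (q := q) (κ := κ) (Rel.act (b := b) g (b i))
    rw [vec_basis] at this
    simpa [vec, map_sum, Finset.sum_mul, groupHom] using this
  -- The indices are swapped because the defining relation rewrites `v j * v i` with the scalar `q i
  -- j`.
  · refine ⟨q j i, hq j i, ?_⟩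
    have := toHecke_rel (Rel.comm (b := b) (q := q) (κ := κ) j i)
    rw [map_mul, map_add, map_smul, map_mul] at this
    rw [this, add_sub_cancel_left, grp, Finsupp.sum, map_sum]
    refine sum_mem fun g _ => ?_
    rw [map_smul]
    exact Submodule.smul_mem _ _ (Submodule.subset_span ⟨g, rfl⟩)
  · rw [hmono]; exact hH.1
  · rw [hmono]; exact hH.2

end QuantumDrinfeldHecke

end

theorem mainTheorem4 {K : Type u} {V : Type v} [Field K] [AddCommGroup V] [Module K V] {n : ℕ}
    (b : Module.Basis (Fin n) K V)
    (G : Subgroup (LinearMap.GeneralLinearGroup K V)) [Finite G]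
    (q : Fin n → Fin n → K) (hq : ∀ i j, q i j ≠ 0)
    (κ : Fin n → Fin n → MonoidAlgebra K G)
    (hH : QuantumDrinfeldHecke.IsQuantumDrinfeldHecke G b q κ) :
    (IsNoetherianRing (QuantumDrinfeldHecke.Hecke G b q κ) ∧
      IsNoetherianRing (QuantumDrinfeldHecke.Hecke G b q κ)ᵐᵒᵖ) ∧
    (IsDomain (QuantumDrinfeldHecke.Hecke G b q κ) ↔ G = ⊥) ∧
    QuantumDrinfeldHecke.gkDim K (QuantumDrinfeldHecke.Hecke G b q κ) =
      (n : EReal) + QuantumDrinfeldHecke.gkDim K K ∧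
    (¬ ringChar K ∣ Nat.card G →
      QuantumDrinfeldHecke.leftGlobalDim (QuantumDrinfeldHecke.Hecke G b q κ) ≤ (n : WithBot ℕ∞) ∧
      QuantumDrinfeldHecke.leftGlobalDim (QuantumDrinfeldHecke.Hecke G b q κ)ᵐᵒᵖ ≤
        (n : WithBot ℕ∞)) := by
  have h := hH.isPBW hq
  refine ⟨⟨h.isNoetherianRing, h.opposite.isNoetherianRing⟩, ?_, h.gkDim_eq, fun hG => ?_⟩
  · rw [h.isDomain_iff]
    exact ⟨fun _ => Subgroup.eq_bot_of_subsingleton G, fun hG => hG ▸ inferInstance⟩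
  · have hcard : (Nat.card G : K) ≠ 0 := fun h0 => hG ((ringChar.spec K _).1 h0)
    exact ⟨h.leftGlobalDim_le hcard, h.opposite.leftGlobalDim_le hcard⟩
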